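/- Let $n\ge 1$ be an integer, $\hbar>0$, $s\in\mathbb{R}$, and let $y_1,\dots,y_n$ and $x_1,\dots,x_{n-1}$ be complex numbers. Let $\mathscr{C}\subset\mathbb{C}$ be a contour running from $-\infty$ to $+\infty$ inside a horizontal strip, i.e. it admits a Lipschitz, piecewise $C^1$ parametrization $\gamma:\mathbb{R}\to\mathbb{C}$ (with locally finitely many break points) such that $\Im\gamma$ is bounded and, for some $c>0$ and $C\in\mathbb{R}$, $\Re\gamma(t)\ge ct-C$ for $t\ge 0$ and $\Re\gamma(t)\le ct+C$ for $t\le 0$. Assume that $\mathscr{C}$ circumvents from below all the points $y_a+i\hbar k$ ($1\le a\le n$, $k\in\mathbb{N}=\{0,1,2,\dots\}$) and circumvents from above all the points $x_b-i\hbar k$ ($1\le b\le n-1$, $k\in\mathbb{N}$); that is, each of the former (respectively latter) points can be joined by a path in $\mathbb{C}\setminus\mathscr{C}$ to a point lying higher (respectively lower) than all of $\mathscr{C}$. Then the following integral converges absolutely and $$ \int_{\mathscr{C}^n} e^{\frac{s}{i\hbar}\sum_{a=1}^n w_a}\, \frac{\prod_{a=1}^{n}\Big\{\prod_{b=1}^{n}\Gamma\big(\tfrac{y_b-w_a}{i\hbar}\big)\prod_{b=1}^{n-1}\Gamma\big(\tfrac{w_a-x_b}{i\hbar}\big)\Big\}}{\prod_{a\ne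 b}\Gamma\big(\tfrac{w_a-w_b}{i\hbar}\big)}\, \frac{\mathrm{d}^n w}{(2\pi\hbar)^n} = n!\; e^{\frac{s}{i\hbar}\sum_{a=1}^n y_a}\; e^{-e^{s}}\;\prod_{a=1}^{n}\prod_{b=1}^{n-1}\Gamma\Big(\frac{y_a-x_b}{i\hbar}\Big), $$ where the product in the denominator runs over all ordered pairs $(a,b)$ with $1\le a,b\le n$, $a\ne b$, and $1/\Gamma$ denotes the entire reciprocal Gamma function. -/

import Mathlib

/-- A contour in the complex plane that runs from `-∞` to `+∞` inside a horizontal strip, given by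
a piecewise continuously differentiable parametrization (with a locally finite set of break
points) of bounded speed, whose real part goes to `±∞` at least linearly as `t → ±∞`.
Horizontal lines `ℝ + iα` and their deformations on a bounded set are the basic examples. -/
structure IsStripContour (γ : ℝ → ℂ) : Prop where
  lipschitz : ∃ K, LipschitzWith K γ
  piecewise_contDiff : ∃ S : Set ℝ, (∀ a b : ℝ, (S ∩ Set.Icc a b).Finite) ∧
    ∀ t ∉ S, ContDiffAt ℝ 1 γ t
  im_bounded : ∃ M : ℝ, ∀ t, |(γ t).im| ≤ M
  re_growth : ∃ c > (0 : ℝ), ∃ C : ℝ,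
    (∀ t ≥ 0, c * t - C ≤ (γ t).re) ∧ (∀ t ≤ 0, (γ t).re ≤ c * t + C)

/-- The point `p` lies above the contour `γ` (the contour circumvents `p` from below): avoiding
the contour, `p` can be joined to a point that is higher than the whole contour. -/
def LiesAbove (γ : ℝ → ℂ) (p : ℂ) : Prop :=
  ∃ q : ℂ, (∀ t, (γ t).im < q.im) ∧ JoinedIn (Set.range γ)ᶜ p q

/-- The point `p` lies below the contour `γ` (the contour circumvents `p` from above): avoiding
the contour, `p` can be joined to a point that is lower than the whole contour. -/
def LiesBelow (γ : ℝ → ℂ) (p : ℂ) : Prop :=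
  ∃ q : ℂ, (∀ t, q.im < (γ t).im) ∧ JoinedIn (Set.range γ)ᶜ p q

/-- The integrand of the multiple Mellin-Barnes integral. The denominator is the product over all
ordered pairs `(a, b)` with `a ≠ b`. -/
noncomputable def gammaIntegrand {n m : ℕ} (ℏ s : ℝ) (y : Fin n → ℂ) (x : Fin m → ℂ)
    (w : Fin n → ℂ) : ℂ :=
  Complex.exp (s * (∑ a, w a) / (Complex.I * ℏ)) *
    (∏ a, ((∏ b, Complex.Gamma ((y b - w a) / (Complex.I * ℏ))) *
      ∏ b, Complex.Gamma ((w a - x b) / (Complex.I * ℏ)))) /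
    ∏ p ∈ (Finset.univ : Finset (Fin n)).offDiag,
      Complex.Gamma ((w p.1 - w p.2) / (Complex.I * ℏ))

/-- The pull-back to `ℝⁿ` of the form `F(w) dw₁ ⋯ dwₙ` on `γ × ⋯ × γ`. -/
noncomputable def contourPullback {n : ℕ} (γ : ℝ → ℂ) (F : (Fin n → ℂ) → ℂ)
    (t : Fin n → ℝ) : ℂ :=
  F (fun a => γ (t a)) * ∏ a, deriv γ (t a)

/-!
By the reflection formula, the product of the `1 / Γ ((w_a - w_b) / iℏ)` is the product of a
Vandermonde determinant in the `w_a` and of its hyperbolic analogue, a determinant of exponentials.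
Andréief's identity thus turns the multiple integral into `n!` times a determinant of
one-dimensional Barnes integrals, the moments of a functional on polynomials.

Shifting the contour by `i` (for `ℏ = 1`) relates the moments against `∏ (w - y_b)` and against
`∏ (w - x_b)`. This contiguity relation has two consequences. First, the determinant `D` satisfies
`D' = ((∑ y_a) / i - e ^ s) D` as a function of `s`, so that `D = K e ^ (s ∑ y_a / i) e ^ (-e ^ s)`.
Second, moving `x_b` to `x_b - i` multiplies `D` by `∏_a (y_a - x_b) / i`, as it does the product of
Gamma functions on the right-hand side, which reduces an arbitrary contour to a horizontal line.

The constant `K` is read off as `s → -∞`. Suitable combinations of the columns replace the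
exponentials by products of hyperbolic sines that cancel all the factors `Γ ((y_b - w) / i)` except
one, and the remaining one-dimensional integral is an inverse Mellin transform, which tends to the
value of its weight at `y_k`. The combinations are independent when the `y_b` are generic, and
continuity in `y` gives the other cases.
-/

open Asymptotics Bornology Complex Filter MeasureTheory Set Topology

/-- The integral of `f` along the contour `γ`. -/
noncomputable def contourIntegral (γ : ℝ → ℂ) (f : ℂ → ℂ) : ℂ := ∫ t, f (γ t) * deriv γ t

/-- The filter of neighbourhoods of the two ends of the horizontal strip `a < im w < b`; the
growth of integrands is measured along it. -/
noncomputable def stripEnds (a b : ℝ) : Filter ℂ := cobounded ℂ ⊓ 𝓟 (im ⁻¹' Ioo a b)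

theorem stripEnds_le_cobounded (a b : ℝ) : stripEnds a b ≤ cobounded ℂ := inf_le_left

theorem eventually_stripEnds_mem (a b : ℝ) : ∀ᶠ w in stripEnds a b, w ∈ im ⁻¹' Ioo a b :=
  mem_inf_of_right (mem_principal_self _)

theorem isOpen_strip (a b : ℝ) : IsOpen (im ⁻¹' Ioo a b) := isOpen_Ioo.preimage continuous_im

theorem convex_strip (a b : ℝ) : Convex ℝ (im ⁻¹' Ioo a b) :=
  (convex_Ioo a b).linear_preimage imLm

section ContourIntegral

variable {γ : ℝ → ℂ} {f g : ℂ → ℂ}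

theorem contourIntegral_congr (h : ∀ w ∈ range γ, f w = g w) :
    contourIntegral γ f = contourIntegral γ g := by
  simp only [contourIntegral, fun t => h (γ t) (mem_range_self t)]

theorem contourIntegral_add (hf : Integrable fun t => f (γ t) * deriv γ t)
    (hg : Integrable fun t => g (γ t) * deriv γ t) :
    contourIntegral γ (fun w => f w + g w) = contourIntegral γ f + contourIntegral γ g := by
  simp only [contourIntegral, add_mul]
  exact integral_add hf hg

theorem contourIntegral_sub (hf : Integrable fun t => f (γ t) * deriv γ t)
    (hg : Integrable fun t => g (γ t) * deriv γ t) :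
    contourIntegral γ (fun w => f w - g w) = contourIntegral γ f - contourIntegral γ g := by
  simp only [contourIntegral, sub_mul]
  exact integral_sub hf hg

theorem contourIntegral_sum {ι : Type*} {γ : ℝ → ℂ} (S : Finset ι) {F : ι → ℂ → ℂ}
    (hF : ∀ i ∈ S, Integrable fun t => F i (γ t) * deriv γ t) :
    contourIntegral γ (fun w => ∑ i ∈ S, F i w) = ∑ i ∈ S, contourIntegral γ (F i) := by
  simp only [contourIntegral, Finset.sum_mul]
  exact integral_finsetSum S hF

theorem contourIntegral_const_mul (γ : ℝ → ℂ) (c : ℂ) (f : ℂ → ℂ) :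
    contourIntegral γ (fun w => c * f w) = c * contourIntegral γ f := by
  simp only [contourIntegral, mul_assoc]
  exact integral_const_mul _ _

end ContourIntegral

namespace IsStripContour

variable {γ γ' : ℝ → ℂ} {a b : ℝ} {f : ℂ → ℂ}

theorem continuous (hγ : IsStripContour γ) : Continuous γ :=
  let ⟨_, hK⟩ := hγ.lipschitz
  hK.continuous

theorem exists_countable_hasDerivAt (hγ : IsStripContour γ) :
    ∃ S : Set ℝ, S.Countable ∧ ∀ t ∉ S, HasDerivAt γ (deriv γ t) t := by
  obtain ⟨S, hS, hd⟩ := hγ.piecewise_contDiff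
  refine ⟨S, ?_, fun t ht => ((hd t ht).differentiableAt one_ne_zero).hasDerivAt⟩
  have hcover : S = ⋃ n : ℕ, S ∩ Icc (-n : ℝ) n := by
    rw [← inter_iUnion, left_eq_inter]
    intro t _
    obtain ⟨n, hn⟩ := exists_nat_ge |t|
    exact mem_iUnion.2 ⟨n, abs_le.1 hn⟩
  rw [hcover]
  exact countable_iUnion fun n => (hS _ _).countable

/-- Multiplying by `t` treats both ends of the contour at once. -/
theorem exists_mul_re_growth (hγ : IsStripContour γ) :
    ∃ c > 0, ∀ᶠ t in cocompact ℝ, c * t ^ 2 ≤ t * (γ t).re := by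
  obtain ⟨c, hc, C, hpos, hneg⟩ := hγ.re_growth
  refine ⟨c / 2, half_pos hc, ?_⟩
  filter_upwards [tendsto_norm_cocompact_atTop.eventually_ge_atTop (2 * C / c)] with t ht
  rw [Real.norm_eq_abs, div_le_iff₀ hc] at ht
  rcases le_total 0 t with h | h
  · rw [abs_of_nonneg h] at ht
    nlinarith [hpos t h]
  · rw [abs_of_nonpos h] at ht
    nlinarith [hneg t h]

theorem isBigO_id (hγ : IsStripContour γ) : γ =O[cocompact ℝ] (id : ℝ → ℝ) := by
  obtain ⟨K, hK⟩ := hγ.lipschitz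
  have hsub : (fun t => γ t - γ 0) =O[cocompact ℝ] (id : ℝ → ℝ) :=
    .of_bound K (.of_forall fun t => by simpa using hK.norm_sub_le t 0)
  have hconst : (fun _ : ℝ => γ 0) =O[cocompact ℝ] (id : ℝ → ℝ) :=
    (isLittleO_const_left.2 (.inr tendsto_norm_cocompact_atTop)).isBigO
  simpa using hsub.add hconst

theorem id_isBigO (hγ : IsStripContour γ) : (id : ℝ → ℝ) =O[cocompact ℝ] γ := by
  obtain ⟨c, hc, h⟩ := hγ.exists_mul_re_growth
  refine .of_bound c⁻¹ ?_
  filter_upwards [h, tendsto_norm_cocompact_atTop.eventually_gt_atTop 0] with t ht ht0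
  have hre : |t| * (c * |t|) ≤ |t| * ‖γ t‖ :=
    calc |t| * (c * |t|) = c * t ^ 2 := by rw [← sq_abs]; ring
      _ ≤ |t * (γ t).re| := ht.trans (le_abs_self _)
      _ ≤ |t| * ‖γ t‖ := by rw [abs_mul]; gcongr; exact abs_re_le_norm _
  rw [le_inv_mul_iff₀ hc]
  exact le_of_mul_le_mul_left hre ht0

theorem tendsto_cobounded (hγ : IsStripContour γ) : Tendsto γ (cocompact ℝ) (cobounded ℂ) :=
  tendsto_norm_atTop_iff_cobounded.1 <|
    (isBigO_ofReal_left.2 hγ.id_isBigO).trans_tendsto_norm_atTop <| by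
      simpa only [id, norm_real] using tendsto_norm_cocompact_atTop (E := ℝ)

theorem isClosed_range (hγ : IsStripContour γ) : IsClosed (range γ) :=
  have hproper : IsProperMap γ := isProperMap_iff_tendsto_cocompact.2 ⟨hγ.continuous, by
    simpa only [Metric.cobounded_eq_cocompact] using hγ.tendsto_cobounded⟩
  hproper.isClosedMap.isClosed_range

theorem tendsto_stripEnds (hγ : IsStripContour γ) (him : ∀ t, (γ t).im ∈ Ioo a b) :
    Tendsto γ (cocompact ℝ) (stripEnds a b) :=
  tendsto_inf.2 ⟨hγ.tendsto_cobounded, tendsto_principal.2 (.of_forall him)⟩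

theorem exists_im_mem_Ioo (hγ : IsStripContour γ) : ∃ L, ∀ t, (γ t).im ∈ Ioo (-L) L :=
  let ⟨M, hM⟩ := hγ.im_bounded
  ⟨M + 1, fun t => abs_lt.1 ((hM t).trans_lt (lt_add_one M))⟩

theorem integrable_of_isBigO (hγ : IsStripContour γ) (him : ∀ t, (γ t).im ∈ Ioo a b)
    (hf : ContinuousOn f (range γ)) (hO : f =O[stripEnds a b] fun w => w⁻¹ ^ 2) :
    Integrable fun t => f (γ t) * deriv γ t := by
  obtain ⟨K, hK⟩ := hγ.lipschitz
  have hdecay : (fun t => f (γ t)) =O[cocompact ℝ] fun t : ℝ => (1 + t ^ 2)⁻¹ := by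
    refine (hO.comp_tendsto (hγ.tendsto_stripEnds him)).trans ?_
    refine (((hγ.id_isBigO.inv_rev ?_).pow 2).trans (.of_bound 2 ?_))
    · filter_upwards [tendsto_norm_cocompact_atTop.eventually_gt_atTop 0] with t ht h
      simp [show t = 0 from h] at ht
    · filter_upwards [tendsto_norm_cocompact_atTop.eventually_ge_atTop 1] with t ht
      have h1 : 1 ≤ t ^ 2 := by simpa using one_le_pow₀ (n := 2) ht
      rw [Real.norm_of_nonneg (by positivity), Real.norm_of_nonneg (by positivity), id, inv_pow,
        ← div_eq_mul_inv, inv_le_iff_one_le_mul₀' (by positivity), mul_div_assoc', 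
        one_le_div (by positivity)]
      linarith
  have hint : Integrable fun t => f (γ t) :=
    (hf.comp_continuous hγ.continuous mem_range_self).locallyIntegrable
      |>.integrable_of_isBigO_cocompact hdecay (integrable_inv_one_add_sq.integrableAtFilter _)
  exact hint.mul_bdd (c := K) (measurable_deriv γ).aestronglyMeasurable
    (.of_forall fun t => norm_deriv_le_of_lipschitz hK)

theorem tendsto_primitive (hγ : IsStripContour γ) {G : ℂ → ℂ}
    (hG : ∀ t, HasDerivAt G (f (γ t)) (γ t)) (hi : Integrable fun t => f (γ t) * deriv γ t) :
    Tendsto (fun T => G (γ T) - G (γ (-T))) atTop (𝓝 (contourIntegral γ f)) := by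
  obtain ⟨S, hS, hd⟩ := hγ.exists_countable_hasDerivAt
  refine (intervalIntegral_tendsto_integral hi tendsto_neg_atTop_atBot tendsto_id).congr fun T => ?_
  exact integral_eq_of_hasDerivAt_off_countable (fun t => G (γ t)) _ hS
    (fun t _ => ((hG t).continuousAt.comp hγ.continuous.continuousAt).continuousWithinAt)
    (fun t ht => (hG t).comp_of_eq t (hd t ht.2) rfl) hi.intervalIntegrable

theorem tendsto_sub_comp_neg {u : ℝ → ℂ} {c : ℂ} (hu : Tendsto u (cocompact ℝ) (𝓝 c)) :
    Tendsto (fun T => u T - u (-T)) atTop (𝓝 0) := by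
  simpa using (hu.mono_left atTop_le_cocompact).sub
    ((hu.mono_left atBot_le_cocompact).comp tendsto_neg_atTop_atBot)

theorem contourIntegral_eq_zero_of_hasDerivAt (hγ : IsStripContour γ) {G : ℂ → ℂ} {c : ℂ}
    (hG : ∀ t, HasDerivAt G (f (γ t)) (γ t)) (hi : Integrable fun t => f (γ t) * deriv γ t)
    (hlim : Tendsto G (cobounded ℂ) (𝓝 c)) : contourIntegral γ f = 0 :=
  tendsto_nhds_unique (hγ.tendsto_primitive hG hi)
    (tendsto_sub_comp_neg (hlim.comp hγ.tendsto_cobounded))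

/-- For large `t` both contours have left the disc `‖w‖ < m |t|`, and `γ t` and `γ' t` are in the
same end of the strip, so that `f = O(t⁻²)` on the segment joining them. -/
theorem isBigO_primitive_sub_primitive (hγ : IsStripContour γ) (hγ' : IsStripContour γ')
    (him : ∀ t, (γ t).im ∈ Ioo a b) (him' : ∀ t, (γ' t).im ∈ Ioo a b)
    (hO : f =O[stripEnds a b] fun w => w⁻¹ ^ 2) {G : ℂ → ℂ}
    (hG : ∀ w ∈ im ⁻¹' Ioo a b, HasDerivAt G (f w) w) :
    (fun t => G (γ' t) - G (γ t)) =O[cocompact ℝ] fun t => t⁻¹ ^ 2 * ‖γ' t - γ t‖ := by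
  obtain ⟨c, hc, hre⟩ := hγ.exists_mul_re_growth
  obtain ⟨c', hc', hre'⟩ := hγ'.exists_mul_re_growth
  set m := min c c'
  have hm0 : 0 < m := lt_min hc hc'
  obtain ⟨C, hC0, hC⟩ := hO.exists_nonneg
  obtain ⟨r, hr⟩ : ∃ r, ∀ w : ℂ, r ≤ ‖w‖ → w ∈ im ⁻¹' Ioo a b → ‖f w‖ ≤ C * ‖w⁻¹ ^ 2‖ := by
    simpa [IsBigOWith, stripEnds, eventually_inf_principal,
      (hasBasis_cobounded_norm (E := ℂ)).eventually_iff] using hC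
  refine .of_bound (C * m⁻¹ ^ 2) ?_
  filter_upwards [hre, hre', tendsto_norm_cocompact_atTop.eventually_ge_atTop (r / m),
    tendsto_norm_cocompact_atTop.eventually_gt_atTop 0] with t ht ht' htr ht0
  rw [Real.norm_eq_abs] at htr ht0
  rw [div_le_iff₀ hm0, mul_comm] at htr
  have hconv : Convex ℝ (im ⁻¹' Ioo a b ∩ {w : ℂ | m * t ^ 2 ≤ t * w.re}) :=
    (convex_strip a b).inter ((convex_Ici (m * t ^ 2)).linear_preimage (t • reLm))
  have hnorm (w : ℂ) (hw : m * t ^ 2 ≤ t * w.re) : m * |t| ≤ ‖w‖ := by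
    refine le_trans ?_ (abs_re_le_norm w)
    have hle := hw.trans (le_abs_self _)
    rw [← sq_abs, abs_mul] at hle
    exact le_of_mul_le_mul_left (by linarith) ht0
  have hle := hconv.norm_image_sub_le_of_norm_hasDerivWithin_le (C := C * (m * |t|)⁻¹ ^ 2)
    (fun w hw => (hG w hw.1).hasDerivWithinAt) (fun w hw => ?_)
    (x := γ t) (y := γ' t) ⟨him t, ?_⟩ ⟨him' t, ?_⟩
  · simpa [mul_pow, mul_assoc, mul_comm, mul_left_comm] using hle
  · refine (hr w (htr.trans (hnorm w hw.2)) hw.1).trans ?_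
    rw [norm_pow, norm_inv]
    gcongr
    exact hnorm w hw.2
  · exact (mul_le_mul_of_nonneg_right (min_le_left _ _) (sq_nonneg t)).trans ht
  · exact (mul_le_mul_of_nonneg_right (min_le_right _ _) (sq_nonneg t)).trans ht'

theorem tendsto_primitive_sub_primitive (hγ : IsStripContour γ) (hγ' : IsStripContour γ')
    (him : ∀ t, (γ t).im ∈ Ioo a b) (him' : ∀ t, (γ' t).im ∈ Ioo a b)
    (hO : f =O[stripEnds a b] fun w => w⁻¹ ^ 2) {G : ℂ → ℂ}
    (hG : ∀ w ∈ im ⁻¹' Ioo a b, HasDerivAt G (f w) w) :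
    Tendsto (fun t => G (γ' t) - G (γ t)) (cocompact ℝ) (𝓝 0) := by
  have hlin : (fun t : ℝ => t⁻¹ ^ 2 * ‖γ' t - γ t‖) =O[cocompact ℝ] fun t : ℝ => t⁻¹ := by
    refine ((isBigO_refl _ _).mul (hγ'.isBigO_id.sub hγ.isBigO_id).norm_left).trans
      (.of_bound 1 (.of_forall fun t => ?_))
    rcases eq_or_ne t 0 with rfl | ht
    · simp
    · simp [sq, ht]
  refine ((hγ.isBigO_primitive_sub_primitive hγ' him him' hO hG).trans hlin).trans_tendsto ?_
  simpa [← Metric.cobounded_eq_cocompact] using tendsto_inv₀_cobounded (α := ℝ)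

theorem contourIntegral_eq_of_differentiableOn (hγ : IsStripContour γ) (hγ' : IsStripContour γ')
    (him : ∀ t, (γ t).im ∈ Ioo a b) (him' : ∀ t, (γ' t).im ∈ Ioo a b)
    (hf : DifferentiableOn ℂ f (im ⁻¹' Ioo a b)) (hO : f =O[stripEnds a b] fun w => w⁻¹ ^ 2) :
    contourIntegral γ f = contourIntegral γ' f := by
  obtain ⟨G, hG'⟩ := (convex_strip a b).exists_forall_hasDerivWithinAt hf
  have hG (w : ℂ) (hw : w ∈ im ⁻¹' Ioo a b) : HasDerivAt G (f w) w :=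
    (hG' w hw).hasDerivAt ((isOpen_strip a b).mem_nhds hw)
  have hlim {δ : ℝ → ℂ} (hδ : IsStripContour δ) (hmem : ∀ t, (δ t).im ∈ Ioo a b) :=
    hδ.tendsto_primitive (fun t => hG _ (hmem t)) <| hδ.integrable_of_isBigO hmem
      (hf.continuousOn.mono (range_subset_iff.2 hmem)) hO
  have hdiff := (hlim hγ' him').sub (hlim hγ him)
  refine (sub_eq_zero.1 (tendsto_nhds_unique hdiff ?_)).symm
  convert tendsto_sub_comp_neg (hγ.tendsto_primitive_sub_primitive hγ' him him' hO hG) using 2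
  ring

end IsStripContour

theorem isBigO_inv_sub (p : ℂ) : (fun w => (w - p)⁻¹) =O[cobounded ℂ] fun w => w⁻¹ := by
  have hlin : (fun w => w) =O[cobounded ℂ] fun w => w - p := by
    refine .of_bound 2 ?_
    filter_upwards [tendsto_norm_cobounded_atTop.eventually_ge_atTop (2 * ‖p‖)] with w hw
    linarith [norm_sub_norm_le w p]
  refine hlin.inv_rev ?_
  filter_upwards [eventually_ne_cobounded 0] with w hw h
  exact absurd h hw

theorem isBigO_inv_sub_sub_inv_sub (p q : ℂ) :
    (fun w => (w - p)⁻¹ - (w - q)⁻¹) =O[cobounded ℂ] fun w => w⁻¹ ^ 2 := by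
  have h := ((isBigO_inv_sub p).mul (isBigO_inv_sub q)).const_mul_left (p - q)
  simp only [← sq] at h
  refine h.congr' ?_ .rfl
  filter_upwards [eventually_ne_cobounded p, eventually_ne_cobounded q] with w hp hq
  rw [inv_sub_inv (sub_ne_zero.2 hp) (sub_ne_zero.2 hq), div_eq_mul_inv, mul_inv,
    sub_sub_sub_cancel_left]

namespace IsStripContour

variable {γ : ℝ → ℂ} {p q : ℂ}

theorem integrable_inv_sub_sub_inv_sub (hγ : IsStripContour γ) (hp : p ∉ range γ)
    (hq : q ∉ range γ) : Integrable fun t => ((γ t - p)⁻¹ - (γ t - q)⁻¹) * deriv γ t := by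
  obtain ⟨L, hL⟩ := hγ.exists_im_mem_Ioo
  refine hγ.integrable_of_isBigO hL (f := fun w => (w - p)⁻¹ - (w - q)⁻¹) ?_
    ((isBigO_inv_sub_sub_inv_sub p q).mono (stripEnds_le_cobounded _ _))
  exact ((continuousOn_id.sub continuousOn_const).inv₀ fun w hw =>
      sub_ne_zero.2 (ne_of_mem_of_not_mem hw hp)).sub
    ((continuousOn_id.sub continuousOn_const).inv₀ fun w hw =>
      sub_ne_zero.2 (ne_of_mem_of_not_mem hw hq))

theorem eventually_contourIntegral_inv_sub_sub_inv_sub (hγ : IsStripContour γ) (hp : p ∉ range γ) :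
    ∀ᶠ q in 𝓝 p, q ∉ range γ ∧ contourIntegral γ (fun w => (w - q)⁻¹ - (w - p)⁻¹) = 0 := by
  obtain ⟨δ, hδ, hball⟩ := Metric.isOpen_iff.1 hγ.isClosed_range.isOpen_compl p hp
  filter_upwards [Metric.ball_mem_nhds p hδ] with q hq
  refine ⟨hball hq, hγ.contourIntegral_eq_zero_of_hasDerivAt
    (G := fun w => log (1 + (p - q) / (w - p))) (c := log 1) (fun t => ?_)
    (hγ.integrable_inv_sub_sub_inv_sub (hball hq) hp) ?_⟩
  · have hne : γ t - p ≠ 0 := fun h => hp ⟨t, sub_eq_zero.1 h⟩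
    have hne' : γ t - q ≠ 0 := fun h => hball hq ⟨t, sub_eq_zero.1 h⟩
    have hdist : δ ≤ ‖γ t - p‖ :=
      not_lt.1 fun h => hball (mem_ball_iff_norm.2 h) (mem_range_self t)
    have hlt : ‖(p - q) / (γ t - p)‖ < 1 := by
      rw [norm_div, div_lt_one (norm_pos_iff.2 hne)]
      exact (mem_ball_iff_norm'.1 hq).trans_le hdist
    have hd : HasDerivAt (fun w => 1 + (p - q) / (w - p)) ((p - q) * (-1 / (γ t - p) ^ 2)) (γ t) :=
      ((((hasDerivAt_id (γ t)).sub_const p).fun_inv hne).const_mul (p - q)).const_add 1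
    convert hd.clog (mem_slitPlane_of_norm_lt_one hlt) using 1
    rw [show 1 + (p - q) / (γ t - p) = (γ t - q) / (γ t - p) by field_simp; ring]
    field_simp
    ring
  · have hsmall : Tendsto (fun w => 1 + (p - q) / (w - p)) (cobounded ℂ) (𝓝 1) := by
      simpa [div_eq_mul_inv] using (((isBigO_inv_sub p).trans_tendsto
        (tendsto_inv₀_cobounded (α := ℂ))).const_mul (p - q)).const_add 1
    exact hsmall.clog one_mem_slitPlane

/-- The integral is locally constant as a function of `p`. -/
theorem contourIntegral_of_joinedIn (hγ : IsStripContour γ) (h : JoinedIn (range γ)ᶜ p q) :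
    contourIntegral γ (fun w => (w - p)⁻¹ - (w - q)⁻¹) = 0 := by
  set D : ℂ → ℂ := fun p => contourIntegral γ fun w => (w - p)⁻¹ - (w - q)⁻¹ with hD
  have hloc : ∀ a ∉ range γ, ∀ᶠ b in 𝓝 a, D b = D a := fun a ha => by
    filter_upwards [hγ.eventually_contourIntegral_inv_sub_sub_inv_sub ha] with b ⟨hb, hzero⟩
    rw [hD, ← sub_eq_zero, ← hzero, ← contourIntegral_sub
      (hγ.integrable_inv_sub_sub_inv_sub hb h.target_mem)
      (hγ.integrable_inv_sub_sub_inv_sub ha h.target_mem)]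
    simp only [sub_sub_sub_cancel_right]
  have hconst : IsLocallyConstant (D ∘ h.somePath) := IsLocallyConstant.iff_eventually_eq _ |>.2
    fun τ => h.somePath.continuous.continuousAt.eventually (hloc _ (h.somePath_mem τ))
  have hends := hconst.apply_eq_of_preconnectedSpace 0 1
  simpa [hD, contourIntegral] using hends

theorem mul_add_const (hγ : IsStripContour γ) {r : ℝ} (hr : 0 < r) (c : ℂ) :
    IsStripContour fun t => r * γ t + c where
  lipschitz := by
    obtain ⟨K, hK⟩ := hγ.lipschitz
    refine ⟨‖(r : ℂ)‖₊ * K, LipschitzWith.of_dist_le_mul fun a b => ?_⟩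
    rw [dist_add_right, dist_eq_norm, ← mul_sub, norm_mul, NNReal.coe_mul, coe_nnnorm, mul_assoc]
    gcongr
    simpa [dist_eq_norm] using hK.dist_le_mul a b
  piecewise_contDiff :=
    let ⟨S, hS, hd⟩ := hγ.piecewise_contDiff
    ⟨S, hS, fun t ht => (contDiffAt_const.mul (hd t ht)).add contDiffAt_const⟩
  im_bounded := by
    obtain ⟨M, hM⟩ := hγ.im_bounded
    refine ⟨r * M + |c.im|, fun t => ?_⟩
    rw [add_im, im_ofReal_mul]
    refine (abs_add_le _ _).trans ?_
    rw [abs_mul, abs_of_pos hr]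
    gcongr
    exact hM t
  re_growth := by
    obtain ⟨a, ha, C, h1, h2⟩ := hγ.re_growth
    refine ⟨r * a, mul_pos hr ha, r * C + |c.re|, fun t ht => ?_, fun t ht => ?_⟩
    · rw [add_re, re_ofReal_mul]
      nlinarith [h1 t ht, neg_abs_le c.re]
    · rw [add_re, re_ofReal_mul]
      nlinarith [h2 t ht, le_abs_self c.re]

end IsStripContour

theorem contourIntegral_add_const (γ : ℝ → ℂ) (c : ℂ) (f : ℂ → ℂ) :
    contourIntegral (fun t => γ t + c) f = contourIntegral γ fun w => f (w + c) := by
  simp only [contourIntegral, deriv_add_const]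

/-- The horizontal line at height `α`, traversed from left to right at unit speed. -/
def horizontalLine (α t : ℝ) : ℂ := ⟨t, α⟩

theorem hasDerivAt_horizontalLine (α t : ℝ) : HasDerivAt (horizontalLine α) 1 t := by
  have heq : horizontalLine α = fun t : ℝ => (t : ℂ) + α * I := funext fun t => mk_eq_add_mul_I t α
  rw [heq]
  exact (ofRealCLM.hasDerivAt (x := t)).add_const _

theorem isStripContour_horizontalLine (α : ℝ) : IsStripContour (horizontalLine α) where
  lipschitz := ⟨1, lipschitzWith_of_nnnorm_deriv_le
    (fun t => (hasDerivAt_horizontalLine α t).differentiableAt)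
    fun t => by rw [(hasDerivAt_horizontalLine α t).deriv]; simp⟩
  piecewise_contDiff := ⟨∅, by simp, fun t _ => by
    refine contDiff_one_iff_deriv.2
      ⟨fun t => (hasDerivAt_horizontalLine α t).differentiableAt, ?_⟩ |>.contDiffAt
    simpa only [funext fun t => (hasDerivAt_horizontalLine α t).deriv] using continuous_const⟩
  im_bounded := ⟨|α|, fun _ => le_rfl⟩
  re_growth := ⟨1, one_pos, 0, by simp [horizontalLine], by simp [horizontalLine]⟩

theorem contourIntegral_horizontalLine (α : ℝ) (f : ℂ → ℂ) :
    contourIntegral (horizontalLine α) f = ∫ t, f (horizontalLine α t) := by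
  simp only [contourIntegral, (hasDerivAt_horizontalLine α _).deriv, mul_one]

section Sides

variable {γ : ℝ → ℂ} {p q : ℂ}

theorem joinedIn_compl_range_mul_add_const {r : ℝ} (hr : 0 < r) (c : ℂ)
    (h : JoinedIn (range γ)ᶜ p q) :
    JoinedIn (range fun t => r * γ t + c)ᶜ (r * p + c) (r * q + c) := by
  refine (h.map (f := fun w => r * w + c) (by fun_prop)).mono ?_
  rintro _ ⟨z, hz, rfl⟩ ⟨t, ht⟩
  exact hz ⟨t, mul_left_cancel₀ (ofReal_ne_zero.2 hr.ne') (add_right_cancel ht)⟩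

namespace LiesAbove

theorem of_forall_lt (h : ∀ t, (γ t).im < p.im) : LiesAbove γ p :=
  ⟨p, h, JoinedIn.refl (by rintro ⟨t, rfl⟩; exact lt_irrefl _ (h t))⟩

theorem mul_add_const (h : LiesAbove γ p) {r : ℝ} (hr : 0 < r) (c : ℂ) :
    LiesAbove (fun t => r * γ t + c) (r * p + c) :=
  let ⟨q, hq, hj⟩ := h
  ⟨r * q + c, fun t => by simpa [hr] using hq t, joinedIn_compl_range_mul_add_const hr c hj⟩

theorem joinedIn (h : LiesAbove γ p) (hq : ∀ t, (γ t).im < q.im) :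
    JoinedIn (range γ)ᶜ p q := by
  obtain ⟨q₀, h₀, hj⟩ := h
  have hconv : Convex ℝ {z : ℂ | ∀ t, (γ t).im < z.im} := by
    rw [ofPred_forall]
    exact convex_iInter fun t => convex_halfSpace_im_gt _
  refine hj.trans (((hconv.isPathConnected ⟨q, hq⟩).joinedIn q₀ h₀ q hq).mono ?_)
  rintro z hz ⟨t, rfl⟩
  exact lt_irrefl _ (hz t)

end LiesAbove

namespace LiesBelow

theorem of_forall_lt (h : ∀ t, p.im < (γ t).im) : LiesBelow γ p :=
  ⟨p, h, JoinedIn.refl (by rintro ⟨t, rfl⟩; exact lt_irrefl _ (h t))⟩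

theorem mul_add_const (h : LiesBelow γ p) {r : ℝ} (hr : 0 < r) (c : ℂ) :
    LiesBelow (fun t => r * γ t + c) (r * p + c) :=
  let ⟨q, hq, hj⟩ := h
  ⟨r * q + c, fun t => by simpa [hr] using hq t, joinedIn_compl_range_mul_add_const hr c hj⟩

theorem joinedIn (h : LiesBelow γ p) (hq : ∀ t, q.im < (γ t).im) :
    JoinedIn (range γ)ᶜ p q := by
  obtain ⟨q₀, h₀, hj⟩ := h
  have hconv : Convex ℝ {z : ℂ | ∀ t, z.im < (γ t).im} := by
    rw [ofPred_forall]
    exact convex_iInter fun t => convex_halfSpace_im_lt _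
  refine hj.trans (((hconv.isPathConnected ⟨q, hq⟩).joinedIn q₀ h₀ q hq).mono ?_)
  rintro z hz ⟨t, rfl⟩
  exact lt_irrefl _ (hz t)

end LiesBelow

/-- Joining `L i` to `-L i` without meeting the contour would give
`∫ 2 L i / (t² + L²) dt = 0` on the real line. -/
theorem LiesAbove.not_liesBelow (hγ : IsStripContour γ) (h : LiesAbove γ p) :
    ¬ LiesBelow γ p := fun h' => by
  obtain ⟨L, hL⟩ := hγ.exists_im_mem_Ioo
  have hL0 : 0 < L := by linarith [(hL 0).1.trans (hL 0).2]
  have hzero := hγ.contourIntegral_of_joinedIn <|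
    (h.joinedIn (q := ⟨0, L⟩) fun t => (hL t).2).symm.trans
      (h'.joinedIn (q := ⟨0, -L⟩) fun t => (hL t).1)
  rw [hγ.contourIntegral_eq_of_differentiableOn (isStripContour_horizontalLine 0) hL
    (fun _ => ⟨neg_lt_zero.2 hL0, hL0⟩) ?_
    ((isBigO_inv_sub_sub_inv_sub _ _).mono (stripEnds_le_cobounded _ _)),
    contourIntegral_horizontalLine] at hzero
  · have hreal (t : ℝ) : (horizontalLine 0 t - ⟨0, L⟩)⁻¹ - (horizontalLine 0 t - ⟨0, -L⟩)⁻¹ =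
        2 * I / L * ((1 + (t / L) ^ 2 : ℝ) : ℂ)⁻¹ := by
      have hL' : (L : ℂ) ≠ 0 := ofReal_ne_zero.2 hL0.ne'
      have hpos : (L : ℂ) ^ 2 + (t : ℂ) ^ 2 ≠ 0 := by exact_mod_cast (by positivity)
      have hup : (t : ℂ) - L * I ≠ 0 := fun h => hL0.ne' (by simpa using congrArg im h)
      have hdown : (t : ℂ) + L * I ≠ 0 := fun h => hL0.ne' (by simpa using congrArg im h)
      simp only [horizontalLine, mk_eq_add_mul_I, ofReal_zero, ofReal_neg, zero_mul, add_zero,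
        zero_add, neg_mul, sub_neg_eq_add, ofReal_add, ofReal_one, ofReal_pow, ofReal_div]
      field_simp
      linear_combination 2 * (L : ℂ) ^ 3 * I * I_sq
    simp only [hreal, integral_const_mul, ← ofReal_inv, integral_complex_ofReal,
      Measure.integral_comp_div (fun t : ℝ => (1 + t ^ 2)⁻¹), integral_univ_inv_one_add_sq] at hzero
    simp [hL0.ne', Real.pi_ne_zero] at hzero
  · refine .sub ?_ ?_ <;>
    · refine (differentiableOn_id.sub_const _).inv fun w hw hw0 => ?_
      simp [sub_eq_zero.1 hw0] at hw

end Sides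

theorem differentiableAt_Gamma_of_re_pos {z : ℂ} (hz : 0 < z.re) : DifferentiableAt ℂ Gamma z :=
  differentiableAt_Gamma z fun m hm => by
    rw [hm, neg_re, natCast_re] at hz
    linarith [m.cast_nonneg (α := ℝ)]

theorem exists_eq_replicate_or_eq_cons_cons {α : Type*} [Inhabited α] (S : Multiset α) :
    (∃ p, S = .replicate S.card p) ∨ ∃ p q T, p ≠ q ∧ S = p ::ₘ q ::ₘ T := by
  rcases S.empty_or_exists_mem with rfl | ⟨p, hp⟩
  · exact .inl ⟨default, by simp⟩
  by_cases hall : ∀ q ∈ S, q = p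
  · exact .inl ⟨p, Multiset.eq_replicate_card.2 hall⟩
  push Not at hall
  obtain ⟨q, hq, hqp⟩ := hall
  obtain ⟨S', rfl⟩ := Multiset.exists_cons_of_mem hp
  obtain ⟨T, rfl⟩ := Multiset.exists_cons_of_mem ((Multiset.mem_cons.1 hq).resolve_left hqp)
  exact .inr ⟨p, q, T, hqp.symm, rfl⟩

/-- The function `∏_{p ∈ S} 1 / (w - p)`, which carries the poles of a meromorphic integrand. -/
noncomputable def poleProduct (S : Multiset ℂ) (w : ℂ) : ℂ := (S.map fun p => (w - p)⁻¹).prod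

section PoleProduct

variable {p q w : ℂ} {S T : Multiset ℂ}

@[simp]
theorem poleProduct_zero (w : ℂ) : poleProduct 0 w = 1 := by simp [poleProduct]

theorem poleProduct_cons (p : ℂ) (S : Multiset ℂ) (w : ℂ) :
    poleProduct (p ::ₘ S) w = (w - p)⁻¹ * poleProduct S w := by simp [poleProduct]

theorem poleProduct_add (S T : Multiset ℂ) (w : ℂ) :
    poleProduct (S + T) w = poleProduct S w * poleProduct T w := by simp [poleProduct]

theorem poleProduct_cons_cons (hpq : p ≠ q) (hp : w ≠ p) (hq : w ≠ q) :
    poleProduct (p ::ₘ q ::ₘ T) w =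
      (p - q)⁻¹ * (poleProduct (p ::ₘ T) w - poleProduct (q ::ₘ T) w) := by
  simp only [poleProduct_cons]
  have := sub_ne_zero.2 hpq
  have := sub_ne_zero.2 hp
  have := sub_ne_zero.2 hq
  field_simp
  ring

theorem differentiableAt_poleProduct (hw : w ∉ S) : DifferentiableAt ℂ (poleProduct S) w := by
  induction S using Multiset.induction_on with
  | empty => simpa only [funext poleProduct_zero] using differentiableAt_const 1
  | cons p S ih =>
    rw [Multiset.mem_cons, not_or] at hw
    simp only [funext (poleProduct_cons p S)]
    exact ((differentiableAt_id.sub_const p).inv (sub_ne_zero.2 hw.1)).mul (ih hw.2)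

theorem continuousOn_poleProduct {s : Set ℂ} (hS : ∀ p ∈ S, p ∉ s) :
    ContinuousOn (poleProduct S) s := fun _ hw =>
  (differentiableAt_poleProduct fun h => hS _ h hw).continuousAt.continuousWithinAt

theorem poleProduct_isBigO (hS : 2 ≤ S.card) :
    poleProduct S =O[cobounded ℂ] fun w => w⁻¹ ^ 2 := by
  have hcard : poleProduct S =O[cobounded ℂ] fun w => w⁻¹ ^ S.card := by
    clear hS
    induction S using Multiset.induction_on with
    | empty => simpa [funext poleProduct_zero] using isBigO_refl (fun _ => (1 : ℂ)) _
    | cons p S ih =>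
      simpa only [funext (poleProduct_cons p S), Multiset.card_cons, pow_succ'] using
        (isBigO_inv_sub p).mul ih
  refine hcard.trans (.of_bound 1 ?_)
  filter_upwards [tendsto_norm_cobounded_atTop.eventually_ge_atTop (1 : ℝ)] with w hw
  rw [one_mul, norm_pow, norm_pow, norm_inv]
  exact pow_le_pow_of_le_one (by positivity) (inv_le_one_of_one_le₀ hw) hS

end PoleProduct

theorem exists_eq_mul_sub_add {h : ℂ → ℂ} {U : Set ℂ} {p q : ℂ} (hU : U ∈ 𝓝 p) (hq : q ∉ U)
    (hh : DifferentiableOn ℂ h U) :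
    ∃ k, DifferentiableOn ℂ k U ∧ ∃ c, ∀ w ∈ U, h w = k w * (w - p) + c * (w - q)⁻¹ ^ 2 := by
  have hpq : p - q ≠ 0 := sub_ne_zero.2 (ne_of_mem_of_not_mem (mem_of_mem_nhds hU) hq)
  set g : ℂ → ℂ := fun w => h w - h p * (p - q) ^ 2 * (w - q)⁻¹ ^ 2 with hg
  have hgd : DifferentiableOn ℂ g U := hh.sub <| (((differentiableOn_id.sub_const q).inv
    fun w hw => sub_ne_zero.2 (ne_of_mem_of_not_mem hw hq)).pow 2).const_mul _
  have hgp : g p = 0 := by simp [hg, hpq]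
  refine ⟨dslope g p, (differentiableOn_dslope hU).2 hgd, h p * (p - q) ^ 2, fun w _ => ?_⟩
  have := sub_smul_dslope g p w
  rw [hgp, sub_zero, smul_eq_mul, mul_comm] at this
  rw [this, hg, sub_add_cancel]

/-- The point `p` lies above both contours or below both of them. -/
def SameSide (γ γ' : ℝ → ℂ) (p : ℂ) : Prop :=
  (LiesAbove γ p ∧ LiesAbove γ' p) ∨ (LiesBelow γ p ∧ LiesBelow γ' p)

theorem LiesAbove.notMem_range {γ : ℝ → ℂ} {p : ℂ} (h : LiesAbove γ p) : p ∉ range γ :=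
  let ⟨_, _, hj⟩ := h
  hj.source_mem

theorem LiesBelow.notMem_range {γ : ℝ → ℂ} {p : ℂ} (h : LiesBelow γ p) : p ∉ range γ :=
  let ⟨_, _, hj⟩ := h
  hj.source_mem

namespace SameSide

variable {γ γ' : ℝ → ℂ} {a b : ℝ} {p q : ℂ}

theorem symm (h : SameSide γ γ' p) : SameSide γ' γ p :=
  h.imp And.symm And.symm

theorem notMem_range (h : SameSide γ γ' p) : p ∉ range γ :=
  h.elim (fun h => h.1.notMem_range) fun h => h.1.notMem_range

theorem exists_joinedIn (him : ∀ t, (γ t).im ∈ Ioo a b) (him' : ∀ t, (γ' t).im ∈ Ioo a b)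
    (h : SameSide γ γ' p) : ∃ q ∉ im ⁻¹' Ioo a b,
      JoinedIn (range γ)ᶜ p q ∧ JoinedIn (range γ')ᶜ p q := by
  rcases h with ⟨h, h'⟩ | ⟨h, h'⟩
  · exact ⟨⟨0, b⟩, fun hb => hb.2.false, h.joinedIn fun t => (him t).2,
      h'.joinedIn fun t => (him' t).2⟩
  · exact ⟨⟨0, a⟩, fun ha => ha.1.false, h.joinedIn fun t => (him t).1,
      h'.joinedIn fun t => (him' t).1⟩

theorem contourIntegral_inv_sub_sub_inv_sub (hγ : IsStripContour γ) (hγ' : IsStripContour γ')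
    (him : ∀ t, (γ t).im ∈ Ioo a b) (him' : ∀ t, (γ' t).im ∈ Ioo a b)
    (hp : SameSide γ γ' p) (hq : SameSide γ γ' q) :
    contourIntegral γ (fun w => (w - p)⁻¹ - (w - q)⁻¹) =
      contourIntegral γ' fun w => (w - p)⁻¹ - (w - q)⁻¹ := by
  obtain ⟨P, hP, hpP, hpP'⟩ := hp.exists_joinedIn him him'
  obtain ⟨Q, hQ, hqQ, hqQ'⟩ := hq.exists_joinedIn him him'
  have hmove {δ : ℝ → ℂ} (hδ : IsStripContour δ) (hjp : JoinedIn (range δ)ᶜ p P)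
      (hjq : JoinedIn (range δ)ᶜ q Q) : contourIntegral δ (fun w => (w - p)⁻¹ - (w - q)⁻¹) =
        contourIntegral δ fun w => (w - P)⁻¹ - (w - Q)⁻¹ := by
    have hi₁ := hδ.integrable_inv_sub_sub_inv_sub hjp.source_mem hjp.target_mem
    have hi₂ := hδ.integrable_inv_sub_sub_inv_sub hjq.source_mem hjq.target_mem
    have hi₃ := hδ.integrable_inv_sub_sub_inv_sub hjp.source_mem hjq.source_mem
    have hi₄ := hδ.integrable_inv_sub_sub_inv_sub hjp.target_mem hjq.target_mem
    rw [← sub_eq_zero, ← contourIntegral_sub hi₃ hi₄, ← sub_eq_zero.2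
      ((hδ.contourIntegral_of_joinedIn hjp).trans (hδ.contourIntegral_of_joinedIn hjq).symm),
      ← contourIntegral_sub hi₁ hi₂]
    congr 1 with w
    ring
  rw [hmove hγ hpP hqQ, hmove hγ' hpP' hqQ']
  refine hγ.contourIntegral_eq_of_differentiableOn hγ' him him' (.sub ?_ ?_)
    ((isBigO_inv_sub_sub_inv_sub P Q).mono (stripEnds_le_cobounded a b)) <;>
  exact (differentiableOn_id.sub_const _).inv fun w hw =>
    sub_ne_zero.2 (ne_of_mem_of_not_mem hw ‹_›)

end SameSide

namespace IsStripContour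

variable {γ γ' : ℝ → ℂ} {a b : ℝ} {p : ℂ} {S : Multiset ℂ} {h : ℂ → ℂ}

theorem integrable_poleProduct (hγ : IsStripContour γ) (hS : ∀ p ∈ S, p ∉ range γ)
    (hcard : 2 ≤ S.card) : Integrable fun t => poleProduct S (γ t) * deriv γ t :=
  let ⟨_, hL⟩ := hγ.exists_im_mem_Ioo
  hγ.integrable_of_isBigO hL (continuousOn_poleProduct hS)
    ((poleProduct_isBigO hcard).mono (stripEnds_le_cobounded _ _))

theorem contourIntegral_poleProduct_replicate (hγ : IsStripContour γ) (hp : p ∉ range γ) (n : ℕ) :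
    contourIntegral γ (poleProduct (.replicate (n + 2) p)) = 0 := by
  refine hγ.contourIntegral_eq_zero_of_hasDerivAt
    (G := fun w => -(n + 1 : ℂ)⁻¹ * (w - p)⁻¹ ^ (n + 1)) (c := -(n + 1 : ℂ)⁻¹ * 0 ^ (n + 1))
    (fun t => ?_) (hγ.integrable_poleProduct (fun q hq => Multiset.eq_of_mem_replicate hq ▸ hp)
      (by simp)) ?_
  · have hne : γ t - p ≠ 0 := fun h => hp ⟨t, sub_eq_zero.1 h⟩
    have hn : (n + 1 : ℂ) ≠ 0 := n.cast_add_one_ne_zero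
    refine (((((hasDerivAt_id (γ t)).sub_const p).fun_inv hne).pow (n + 1)).const_mul
      (-(n + 1 : ℂ)⁻¹)).congr_deriv ?_
    simp only [poleProduct, Multiset.map_replicate, Multiset.prod_replicate, Nat.cast_succ, id,
      Nat.add_sub_cancel, inv_pow]
    field_simp
    ring
  · exact (((isBigO_inv_sub p).trans_tendsto tendsto_inv₀_cobounded).pow _).const_mul _

theorem contourIntegral_poleProduct_eq (hγ : IsStripContour γ) (hγ' : IsStripContour γ')
    (him : ∀ t, (γ t).im ∈ Ioo a b) (him' : ∀ t, (γ' t).im ∈ Ioo a b)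
    (hS : ∀ p ∈ S, SameSide γ γ' p) (hcard : 2 ≤ S.card) :
    contourIntegral γ (poleProduct S) = contourIntegral γ' (poleProduct S) := by
  induction S using Multiset.strongInductionOn with | ih S ih => ?_
  rcases exists_eq_replicate_or_eq_cons_cons S with ⟨p, hSp⟩ | ⟨p, q, T, hpq, rfl⟩
  · obtain ⟨n, hn⟩ := Nat.exists_eq_add_of_le' hcard
    have hp : SameSide γ γ' p := hS p (by rw [hSp]; exact Multiset.mem_replicate.2 ⟨by omega, rfl⟩)
    rw [hSp, hn, hγ.contourIntegral_poleProduct_replicate hp.notMem_range,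
      hγ'.contourIntegral_poleProduct_replicate hp.symm.notMem_range]
  have hsplit {δ δ' : ℝ → ℂ} (hside : ∀ z ∈ p ::ₘ q ::ₘ T, SameSide δ δ' z) :
      contourIntegral δ (poleProduct (p ::ₘ q ::ₘ T)) = (p - q)⁻¹ *
        contourIntegral δ fun w => poleProduct (p ::ₘ T) w - poleProduct (q ::ₘ T) w := by
    rw [← contourIntegral_const_mul]
    refine contourIntegral_congr fun w hw => poleProduct_cons_cons hpq ?_ ?_
    · exact ne_of_mem_of_not_mem hw (hside p (by simp)).notMem_range
    · exact ne_of_mem_of_not_mem hw (hside q (by simp)).notMem_range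
  rw [hsplit hS, hsplit fun z hz => (hS z hz).symm]
  congr 1
  rcases T.empty_or_exists_mem with rfl | ⟨r, hr⟩
  · simpa only [poleProduct_cons, poleProduct_zero, mul_one] using
      (hS p (by simp)).contourIntegral_inv_sub_sub_inv_sub hγ hγ' him him' (hS q (by simp))
  have hcardT : 0 < T.card := Multiset.card_pos_iff_exists_mem.2 ⟨r, hr⟩
  have hsub {z : ℂ} (hz : z ∈ p ::ₘ q ::ₘ T) : ∀ w ∈ z ::ₘ T, SameSide γ γ' w := fun w hw =>
    (Multiset.mem_cons.1 hw).elim (· ▸ hS z hz) fun hw => hS w (by simp [hw])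
  have hi {δ δ' : ℝ → ℂ} (hδ : IsStripContour δ) {z : ℂ} (hz : ∀ w ∈ z ::ₘ T, SameSide δ δ' w) :=
    hδ.integrable_poleProduct (fun w hw => (hz w hw).notMem_range) (by simpa)
  rw [contourIntegral_sub (hi hγ (hsub (by simp))) (hi hγ (hsub (by simp))),
    contourIntegral_sub (hi hγ' fun w hw => (hsub (by simp) w hw).symm)
      (hi hγ' fun w hw => (hsub (by simp) w hw).symm),
    ih _ (Multiset.lt_cons_self _ _ |>.trans_eq (Multiset.cons_swap _ _ _)) (hsub (by simp))
      (by simpa),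
    ih _ (Multiset.lt_cons_self _ _) (hsub (by simp)) (by simpa)]

theorem integrable_mul_poleProduct (hγ : IsStripContour γ) (him : ∀ t, (γ t).im ∈ Ioo a b)
    (hS : ∀ p ∈ S, p ∉ range γ) (hh : DifferentiableOn ℂ h (im ⁻¹' Ioo a b))
    (hO : (fun w => h w * poleProduct S w) =O[stripEnds a b] fun w => w⁻¹ ^ 2) :
    Integrable fun t => h (γ t) * poleProduct S (γ t) * deriv γ t :=
  hγ.integrable_of_isBigO him
    ((hh.continuousOn.mono (range_subset_iff.2 him)).mul (continuousOn_poleProduct hS)) hO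

/-- The value of `h` at `p` is removed by a multiple of `(w - b i)⁻²`, whose pole is outside the
strip; the quotient of the remainder by `w - p` is holomorphic. -/
theorem exists_mul_poleProduct_cons_eq (hp : p ∈ im ⁻¹' Ioo a b)
    (hh : DifferentiableOn ℂ h (im ⁻¹' Ioo a b))
    (hO : (fun w => h w * poleProduct (p ::ₘ S) w) =O[stripEnds a b] fun w => w⁻¹ ^ 2) :
    ∃ k, DifferentiableOn ℂ k (im ⁻¹' Ioo a b) ∧
      (fun w => k w * poleProduct S w) =O[stripEnds a b] (fun w => w⁻¹ ^ 2) ∧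
      ∃ c, ∀ w ∈ im ⁻¹' Ioo a b, w ≠ p → h w * poleProduct (p ::ₘ S) w =
        k w * poleProduct S w + c * poleProduct (⟨0, b⟩ ::ₘ ⟨0, b⟩ ::ₘ p ::ₘ S) w := by
  have hq : (⟨0, b⟩ : ℂ) ∉ im ⁻¹' Ioo a b := fun hb => hb.2.false
  obtain ⟨k, hk, c, hkc⟩ := exists_eq_mul_sub_add ((isOpen_strip a b).mem_nhds hp) hq hh
  have hsplit : ∀ w ∈ im ⁻¹' Ioo a b, w ≠ p → h w * poleProduct (p ::ₘ S) w =
      k w * poleProduct S w + c * poleProduct (⟨0, b⟩ ::ₘ ⟨0, b⟩ ::ₘ p ::ₘ S) w := by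
    intro w hw hwp
    simp only [hkc w hw, poleProduct_cons]
    field_simp [sub_ne_zero.2 hwp]
  refine ⟨k, hk, ?_, c, hsplit⟩
  refine (hO.sub (((poleProduct_isBigO (S := ⟨0, b⟩ ::ₘ ⟨0, b⟩ ::ₘ p ::ₘ S) (by simp)).mono
    (stripEnds_le_cobounded a b)).const_mul_left c)).congr' ?_ .rfl
  filter_upwards [eventually_stripEnds_mem a b,
    (eventually_ne_cobounded p).filter_mono (stripEnds_le_cobounded a b)] with w hw hwp
  rw [hsplit w hw hwp, add_sub_cancel_right]

theorem contourIntegral_mul_poleProduct_eq (hγ : IsStripContour γ) (hγ' : IsStripContour γ')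
    (him : ∀ t, (γ t).im ∈ Ioo a b) (him' : ∀ t, (γ' t).im ∈ Ioo a b)
    (hS : ∀ p ∈ S, SameSide γ γ' p) (hh : DifferentiableOn ℂ h (im ⁻¹' Ioo a b))
    (hO : (fun w => h w * poleProduct S w) =O[stripEnds a b] fun w => w⁻¹ ^ 2) :
    contourIntegral γ (fun w => h w * poleProduct S w) =
      contourIntegral γ' fun w => h w * poleProduct S w := by
  induction S using Multiset.induction_on generalizing h with
  | empty =>
    simp only [poleProduct_zero, mul_one] at hO ⊢
    exact hγ.contourIntegral_eq_of_differentiableOn hγ' him him' hh hO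
  | cons p S ih =>
    have hS' : ∀ z ∈ S, SameSide γ γ' z := fun z hz => hS z (Multiset.mem_cons_of_mem hz)
    by_cases hp : p ∈ im ⁻¹' Ioo a b
    · obtain ⟨k, hk, hkO, c, hsplit⟩ := exists_mul_poleProduct_cons_eq hp hh hO
      set R : Multiset ℂ := ⟨0, b⟩ ::ₘ ⟨0, b⟩ ::ₘ p ::ₘ S with hR
      have hq : SameSide γ γ' ⟨0, b⟩ :=
        .inl ⟨.of_forall_lt fun t => (him t).2, .of_forall_lt fun t => (him' t).2⟩
      have hside : ∀ z ∈ R, SameSide γ γ' z := by simpa [hR, hq] using hS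
      have hadd {δ δ' : ℝ → ℂ} (hδ : IsStripContour δ) (hmem : ∀ t, (δ t).im ∈ Ioo a b)
          (hz : ∀ z ∈ R, SameSide δ δ' z) :
          contourIntegral δ (fun w => h w * poleProduct (p ::ₘ S) w) =
            contourIntegral δ (fun w => k w * poleProduct S w) +
              c * contourIntegral δ (poleProduct R) := by
        rw [← contourIntegral_const_mul, ← contourIntegral_add]
        · refine contourIntegral_congr fun w hw => hsplit w ?_
            (ne_of_mem_of_not_mem hw (hz p (by simp [hR])).notMem_range)
          exact range_subset_iff (s := im ⁻¹' Ioo a b).2 hmem hw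
        · exact hδ.integrable_mul_poleProduct hmem
            (fun z hzS => (hz z (by simp [hR, hzS])).notMem_range) hk hkO
        · simpa only [mul_assoc] using (hδ.integrable_poleProduct
            (fun z hzR => (hz z hzR).notMem_range) (by simp [hR])).const_mul c
      rw [hadd hγ him hside, hadd hγ' him' fun z hz => (hside z hz).symm, ih hS' hk hkO,
        hγ.contourIntegral_poleProduct_eq hγ' him him' hside (by simp [hR])]
    · have hh' : DifferentiableOn ℂ (fun w => h w * (w - p)⁻¹) (im ⁻¹' Ioo a b) :=
        hh.mul <| (differentiableOn_id.sub_const p).inv fun w hw =>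
          sub_ne_zero.2 (ne_of_mem_of_not_mem hw hp)
      simp only [poleProduct_cons, ← mul_assoc] at hO ⊢
      exact ih hS' hh' hO

end IsStripContour

/-- On the strip `a < im w < b` the function `f` is meromorphic with finitely many poles, all of
them in `A`, and takes at its poles the values given by `0⁻¹ = 0`. -/
def MeromorphicOnStrip (a b : ℝ) (A : Set ℂ) (f : ℂ → ℂ) : Prop :=
  ∃ S : Multiset ℂ, (∀ p ∈ S, p ∈ A) ∧ ∃ h, DifferentiableOn ℂ h (im ⁻¹' Ioo a b) ∧
    ∀ w ∈ im ⁻¹' Ioo a b, f w = h w * poleProduct S w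

namespace MeromorphicOnStrip

variable {γ γ' : ℝ → ℂ} {a b : ℝ} {A : Set ℂ} {f g : ℂ → ℂ}

theorem of_differentiable (hf : Differentiable ℂ f) : MeromorphicOnStrip a b A f :=
  ⟨0, by simp, f, hf.differentiableOn, by simp⟩

theorem mul (hf : MeromorphicOnStrip a b A f) (hg : MeromorphicOnStrip a b A g) :
    MeromorphicOnStrip a b A fun w => f w * g w := by
  obtain ⟨S, hS, h, hh, hfh⟩ := hf
  obtain ⟨T, hT, k, hk, hgk⟩ := hg
  refine ⟨S + T, fun p hp => (Multiset.mem_add.1 hp).elim (hS p) (hT p), fun w => h w * k w,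
    hh.mul hk, fun w hw => ?_⟩
  simp only [hfh w hw, hgk w hw, poleProduct_add, mul_mul_mul_comm]

theorem prod {ι : Type*} {s : Finset ι} {F : ι → ℂ → ℂ}
    (hF : ∀ i ∈ s, MeromorphicOnStrip a b A (F i)) :
    MeromorphicOnStrip a b A fun w => ∏ i ∈ s, F i w := by
  classical
  induction s using Finset.induction_on with
  | empty => simpa using of_differentiable (differentiable_const 1)
  | insert i s hi ih =>
    simp only [Finset.prod_insert hi]
    exact (hF i (s.mem_insert_self i)).mul (ih fun j hj => hF j (Finset.mem_insert_of_mem hj))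

/-- `Γ(u + 1) = u Γ(u)` gives `Γ(u) = Γ(u + 1) / u` also at `u = 0`, where both sides are `0`. -/
theorem Gamma_comp {u : ℂ → ℂ} {c : ℂ} (hc : c ≠ 0) {p : ℂ} (hu : ∀ w, u w = c * (w - p))
    (hbdd : ∃ B : ℝ, ∀ w ∈ im ⁻¹' Ioo a b, B < (u w).re) (hA : ∀ k : ℕ, p - k / c ∈ A) :
    MeromorphicOnStrip a b A fun w => Gamma (u w) := by
  have hrec (n : ℕ) : ∃ S : Multiset ℂ, (∀ q ∈ S, q ∈ A) ∧ ∃ d : ℂ, ∀ w,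
      Gamma (u w) = d * Gamma (u w + n) * poleProduct S w := by
    induction n with
    | zero => exact ⟨0, by simp, 1, by simp⟩
    | succ n ih =>
      obtain ⟨S, hS, d, hd⟩ := ih
      refine ⟨(p - n / c) ::ₘ S, by simpa [hA n] using hS, d * c⁻¹, fun w => ?_⟩
      have hlin : u w + n = c * (w - (p - n / c)) := by rw [hu]; field_simp; ring
      have hstep : Gamma (u w + n) = Gamma (u w + (n + 1 : ℕ)) * (u w + n)⁻¹ := by
        rcases eq_or_ne (u w + n) 0 with h0 | h0
        · rw [h0, Gamma_zero, inv_zero, mul_zero]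
        · rw [Nat.cast_succ, ← add_assoc, Gamma_add_one _ h0, mul_comm, inv_mul_cancel_left₀ h0]
      rw [hd, hstep, hlin, poleProduct_cons, mul_inv]
      ring
  obtain ⟨B, hB⟩ := hbdd
  obtain ⟨n, hn⟩ := exists_nat_ge (-B)
  obtain ⟨S, hS, d, hd⟩ := hrec n
  refine ⟨S, hS, fun w => d * Gamma (u w + n), fun w hw => ?_, fun w _ => hd w⟩
  have hpos : 0 < (u w + n).re := by rw [add_re, natCast_re]; linarith [hB w hw]
  have hud : DifferentiableAt ℂ u w := by rw [funext hu]; fun_prop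
  exact (((differentiableAt_Gamma_of_re_pos hpos).comp w
    (hud.add_const (n : ℂ))).const_mul d).differentiableWithinAt

theorem integrable (hf : MeromorphicOnStrip a b A f) (hγ : IsStripContour γ)
    (him : ∀ t, (γ t).im ∈ Ioo a b) (hA : ∀ p ∈ A, p ∉ range γ)
    (hO : f =O[stripEnds a b] fun w => w⁻¹ ^ 2) : Integrable fun t => f (γ t) * deriv γ t := by
  obtain ⟨S, hS, h, hh, hfh⟩ := hf
  have hf' : f =ᶠ[stripEnds a b] fun w => h w * poleProduct S w :=
    (eventually_stripEnds_mem a b).mono hfh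
  simp only [fun t => hfh (γ t) (him t)]
  exact hγ.integrable_mul_poleProduct him (fun p hp => hA p (hS p hp)) hh (hf'.symm.trans_isBigO hO)

theorem contourIntegral_eq (hf : MeromorphicOnStrip a b A f) (hγ : IsStripContour γ)
    (hγ' : IsStripContour γ') (him : ∀ t, (γ t).im ∈ Ioo a b) (him' : ∀ t, (γ' t).im ∈ Ioo a b)
    (hA : ∀ p ∈ A, SameSide γ γ' p) (hO : f =O[stripEnds a b] fun w => w⁻¹ ^ 2) :
    contourIntegral γ f = contourIntegral γ' f := by
  obtain ⟨S, hS, h, hh, hfh⟩ := hf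
  have hf' : f =ᶠ[stripEnds a b] fun w => h w * poleProduct S w :=
    (eventually_stripEnds_mem a b).mono hfh
  have heq {δ : ℝ → ℂ} (hmem : ∀ t, (δ t).im ∈ Ioo a b) :
      contourIntegral δ f = contourIntegral δ fun w => h w * poleProduct S w :=
    contourIntegral_congr (forall_mem_range.2 fun t => hfh _ (hmem t))
  rw [heq him, heq him']
  exact hγ.contourIntegral_mul_poleProduct_eq hγ' him him' (fun p hp => hA p (hS p hp)) hh
    (hf'.symm.trans_isBigO hO)

end MeromorphicOnStrip

theorem norm_GammaSeq {z : ℂ} {n : ℕ} (hn : n ≠ 0) :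
    ‖GammaSeq z n‖ = n ^ z.re * n.factorial / ∏ j ∈ Finset.range (n + 1), ‖z + j‖ := by
  rw [GammaSeq, norm_div, norm_mul, norm_prod, norm_natCast_cpow_of_pos (Nat.pos_of_ne_zero hn),
    Complex.norm_natCast]

/-- The ratio `‖Γ(σ + i τ)‖ / Γ(σ)` is the infinite product of `‖1 + i τ / (σ + j)‖⁻¹`, each
factor of which increases with `σ`. -/
theorem norm_Gamma_mul_norm_Gamma_re_le {z w : ℂ} (hz : 0 < z.re) (hre : z.re ≤ w.re)
    (him : z.im = w.im) : ‖Gamma z‖ * ‖Gamma w.re‖ ≤ ‖Gamma z.re‖ * ‖Gamma w‖ := by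
  refine le_of_tendsto_of_tendsto
    ((GammaSeq_tendsto_Gamma z).norm.mul (GammaSeq_tendsto_Gamma w.re).norm)
    ((GammaSeq_tendsto_Gamma z.re).norm.mul (GammaSeq_tendsto_Gamma w).norm) ?_
  filter_upwards [eventually_ne_atTop 0] with n hn
  have hpos {v : ℂ} (hv : 0 < v.re) (j : ℕ) : 0 < ‖v + j‖ := norm_pos_iff.2 fun h => by
    have := congrArg re h
    rw [add_re, natCast_re, zero_re] at this
    linarith [j.cast_nonneg (α := ℝ)]
  have hfactor (j : ℕ) : ‖(z.re : ℂ) + j‖ * ‖w + j‖ ≤ ‖z + j‖ * ‖(w.re : ℂ) + j‖ := by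
    refine le_of_sq_le_sq ?_ (by positivity)
    simp only [mul_pow, Complex.sq_norm, normSq_apply, add_re, add_im, ofReal_re, ofReal_im,
      natCast_re, natCast_im, add_zero, him]
    have hsq : (z.re + j) ^ 2 ≤ (w.re + j) ^ 2 := by gcongr
    linarith [mul_le_mul_of_nonneg_right hsq (sq_nonneg w.im)]
  have hw : 0 < w.re := hz.trans_le hre
  simp only [norm_GammaSeq hn, ofReal_re, div_mul_div_comm, ← Finset.prod_mul_distrib]
  exact div_le_div_of_nonneg_left (by positivity)
    (Finset.prod_pos fun j _ => mul_pos (hpos (by simpa using hz) j) (hpos hw j))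
    (Finset.prod_le_prod (fun j _ => by positivity) fun j _ => hfactor j)

theorem norm_Gamma_half_add_mul_I_le (τ : ℝ) :
    ‖Gamma (1 / 2 + τ * I)‖ ≤ √(2 * Real.pi) * Real.exp (-(Real.pi / 2 * |τ|)) := by
  have hconj : (1 - (1 / 2 + τ * I) : ℂ) = (starRingEnd ℂ) (1 / 2 + τ * I) := by
    simp only [map_add, map_mul, conj_ofReal, conj_I, map_div₀, map_one, map_ofNat]
    ring
  have hsin : sin (Real.pi * (1 / 2 + τ * I)) = (Real.cosh (Real.pi * |τ|) : ℝ) := by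
    rw [← abs_of_pos Real.pi_pos, ← abs_mul, Real.cosh_abs, abs_of_pos Real.pi_pos, ofReal_cosh,
      ← cos_mul_I, ← sin_add_pi_div_two]
    push_cast
    ring_nf
  have hsq := Gamma_mul_Gamma_one_sub (1 / 2 + τ * I)
  rw [hconj, Gamma_conj, mul_conj, hsin, ← ofReal_div, ofReal_inj, normSq_eq_norm_sq] at hsq
  refine le_of_sq_le_sq ?_ (by positivity)
  have hcosh : Real.exp (Real.pi * |τ|) / 2 ≤ Real.cosh (Real.pi * |τ|) := by
    rw [Real.cosh_eq]
    linarith [Real.exp_pos (-(Real.pi * |τ|))]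
  calc ‖Gamma (1 / 2 + τ * I)‖ ^ 2 ≤ Real.pi / (Real.exp (Real.pi * |τ|) / 2) := by
        rw [hsq]
        gcongr
    _ = (√(2 * Real.pi) * Real.exp (-(Real.pi / 2 * |τ|))) ^ 2 := by
        rw [mul_pow, Real.sq_sqrt (by positivity), ← Real.exp_nat_mul,
          show ((2 : ℕ) : ℝ) * -(Real.pi / 2 * |τ|) = -(Real.pi * |τ|) by push_cast; ring,
          Real.exp_neg]
        field_simp

theorem exists_norm_Gamma_half_add_nat_le (N : ℕ) {θ : ℝ} (hθ : θ < Real.pi / 2) :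
    ∃ C, ∀ τ : ℝ, ‖Gamma (1 / 2 + τ * I + N)‖ ≤ C * Real.exp (-(θ * |τ|)) := by
  induction N generalizing θ with
  | zero =>
    refine ⟨√(2 * Real.pi), fun τ => ?_⟩
    rw [Nat.cast_zero, add_zero]
    refine (norm_Gamma_half_add_mul_I_le τ).trans ?_
    gcongr
  | succ N ih =>
    obtain ⟨η, hθη, hη⟩ := exists_between hθ
    obtain ⟨C, hC⟩ := ih hη
    refine ⟨((1 / 2 + N) + (η - θ)⁻¹) * C, fun τ => ?_⟩
    have hδ : 0 < η - θ := sub_pos.2 hθη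
    have hne : (1 / 2 + τ * I + N : ℂ) ≠ 0 := fun h => by
      have := congrArg re h
      norm_num at this
      linarith [N.cast_nonneg (α := ℝ)]
    have hnorm : ‖(1 / 2 + τ * I + N : ℂ)‖ ≤
        ((1 / 2 + N) + (η - θ)⁻¹) * Real.exp ((η - θ) * |τ|) := by
      have habs : |τ| ≤ (η - θ)⁻¹ * Real.exp ((η - θ) * |τ|) :=
        (le_inv_mul_iff₀ hδ).2 ((lt_add_one _).le.trans (Real.add_one_le_exp _))
      have hone : (1 / 2 + N : ℝ) ≤ (1 / 2 + N) * Real.exp ((η - θ) * |τ|) :=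
        le_mul_of_one_le_right (by positivity) (Real.one_le_exp (by positivity))
      refine (norm_add₃_le).trans ?_
      rw [norm_mul, norm_I, norm_real, Complex.norm_natCast, Real.norm_eq_abs]
      norm_num at hone ⊢
      linarith
    rw [Nat.cast_succ, ← add_assoc, Gamma_add_one _ hne, norm_mul]
    refine (mul_le_mul hnorm (hC τ) (norm_nonneg _) (by positivity)).trans_eq ?_
    rw [mul_mul_mul_comm, ← Real.exp_add]
    ring_nf

theorem exists_norm_Gamma_le {a b θ : ℝ} (ha : 0 < a) (hθ : θ < Real.pi / 2) :
    ∃ C, ∀ z : ℂ, z.re ∈ Icc a b → ‖Gamma z‖ ≤ C * Real.exp (-(θ * |z.im|)) := by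
  obtain ⟨N, hN⟩ := exists_nat_gt b
  obtain ⟨C, hC⟩ := exists_norm_Gamma_half_add_nat_le N hθ
  have hcont : ContinuousOn Real.Gamma (Icc a b) :=
    Real.differentiableOn_Gamma_Ioi.continuousOn.mono fun r hr => ha.trans_le hr.1
  obtain ⟨K, hK⟩ := isCompact_Icc.exists_bound_of_continuousOn hcont
  refine ⟨K / Real.Gamma (1 / 2 + N) * C, fun z hz => ?_⟩
  have hre : (1 / 2 + z.im * I + N : ℂ).re = 1 / 2 + N := by simp
  have hGamma : 0 < Real.Gamma (1 / 2 + N) := Real.Gamma_pos_of_pos (by positivity)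
  have hle := norm_Gamma_mul_norm_Gamma_re_le (w := 1 / 2 + z.im * I + N) (ha.trans_le hz.1)
    (by rw [hre]; linarith [hz.2]) (by simp)
  rw [hre, Gamma_ofReal, Gamma_ofReal, norm_real, norm_real, Real.norm_of_nonneg hGamma.le,
    ← le_div_iff₀ hGamma] at hle
  refine hle.trans ?_
  rw [div_mul_eq_mul_div, div_mul_eq_mul_div, mul_assoc]
  have hKz := hK _ hz
  gcongr
  · exact (norm_nonneg _).trans hKz
  · exact hC _

theorem exists_abs_im_le (a b : ℝ) : ∃ L, ∀ w ∈ im ⁻¹' Ioo a b, |w.im| ≤ L :=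
  ⟨max |a| |b|, fun _ hw => abs_le_max_abs_abs hw.1.le hw.2.le⟩

/-- On the strip `a < im w < b`, the function `f` grows at most like `exp (α |re w|)`, up to
subexponential factors, as `re w → ±∞`. -/
def HasExpType (a b α : ℝ) (f : ℂ → ℂ) : Prop :=
  ∀ β > α, f =O[stripEnds a b] fun w => Real.exp (β * |w.re|)

namespace HasExpType

variable {a b α β : ℝ} {f g : ℂ → ℂ}

theorem congr (hf : HasExpType a b α f) (h : f =ᶠ[stripEnds a b] g) : HasExpType a b α g :=
  fun δ hδ => (hf δ hδ).congr' h .rfl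

theorem add (hf : HasExpType a b α f) (hg : HasExpType a b α g) :
    HasExpType a b α fun w => f w + g w :=
  fun δ hδ => (hf δ hδ).add (hg δ hδ)

theorem mul (hf : HasExpType a b α f) (hg : HasExpType a b β g) :
    HasExpType a b (α + β) fun w => f w * g w := by
  intro δ hδ
  refine ((hf (α + (δ - (α + β)) / 2) (by linarith)).mul
    (hg (β + (δ - (α + β)) / 2) (by linarith))).congr_right fun w => ?_
  rw [← Real.exp_add]
  ring_nf

theorem of_isBigO_one (hf : f =O[stripEnds a b] fun _ => (1 : ℝ)) : HasExpType a b 0 f :=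
  fun β hβ => hf.trans <| .of_bound 1 <| .of_forall fun w => by
    rw [one_mul, norm_one, Real.norm_of_nonneg (Real.exp_pos _).le]
    exact Real.one_le_exp (by positivity)

theorem const (c : ℂ) : HasExpType a b 0 fun _ => c :=
  of_isBigO_one (isBigO_const_const c one_ne_zero _)

theorem prod {ι : Type*} {s : Finset ι} {F : ι → ℂ → ℂ} {α : ι → ℝ}
    (hF : ∀ i ∈ s, HasExpType a b (α i) (F i)) :
    HasExpType a b (∑ i ∈ s, α i) fun w => ∏ i ∈ s, F i w := by
  classical
  induction s using Finset.induction_on with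
  | empty => simpa only [Finset.prod_empty, Finset.sum_empty] using const 1
  | insert i s hi ih =>
    simp only [Finset.prod_insert hi, Finset.sum_insert hi]
    exact (hF i (s.mem_insert_self i)).mul (ih fun j hj => hF j (Finset.mem_insert_of_mem hj))

theorem exp_mul_add (c d : ℂ) : HasExpType a b |c.re| fun w => exp (c * w + d) := by
  intro β hβ
  obtain ⟨L, hL⟩ := exists_abs_im_le a b
  refine .of_bound (Real.exp (|c.im| * L + d.re)) ?_
  filter_upwards [eventually_stripEnds_mem a b] with w hw
  rw [norm_exp, Real.norm_of_nonneg (Real.exp_pos _).le, ← Real.exp_add, Real.exp_le_exp, add_re,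
    mul_re]
  have hre : c.re * w.re ≤ β * |w.re| := (le_abs_self _).trans <| by
    rw [abs_mul]
    gcongr
  have him : -(c.im * w.im) ≤ |c.im| * L := (neg_le_abs _).trans <| by
    rw [abs_mul]
    exact mul_le_mul_of_nonneg_left (hL w hw) (abs_nonneg _)
  linarith

theorem id : HasExpType a b 0 fun w => w := by
  intro β hβ
  obtain ⟨L, hL⟩ := exists_abs_im_le a b
  refine .of_bound (β⁻¹ + L) ?_
  filter_upwards [eventually_stripEnds_mem a b] with w hw
  rw [Real.norm_of_nonneg (Real.exp_pos _).le, add_mul]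
  have hre : |w.re| ≤ β⁻¹ * Real.exp (β * |w.re|) :=
    (le_inv_mul_iff₀ hβ).2 ((lt_add_one _).le.trans (Real.add_one_le_exp _))
  have hL₀ : 0 ≤ L := (abs_nonneg _).trans (hL w hw)
  have him : |w.im| ≤ L * Real.exp (β * |w.re|) := (hL w hw).trans
    (le_mul_of_one_le_right hL₀ (Real.one_le_exp (mul_nonneg hβ.le (abs_nonneg _))))
  linarith [norm_le_abs_re_add_abs_im w]

theorem polynomial_comp (p : Polynomial ℂ) (hf : HasExpType a b 0 f) :
    HasExpType a b 0 fun w => p.eval (f w) := by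
  induction p using Polynomial.induction_on' with
  | add p q hp hq => simpa only [Polynomial.eval_add] using hp.add hq
  | monomial n c =>
    simpa using (const c).mul (prod (s := Finset.range n) fun _ _ => hf)

theorem isBigO_inv_sq (hf : HasExpType a b α f) (hα : α < 0) :
    f =O[stripEnds a b] fun w => w⁻¹ ^ 2 := by
  refine (hf (α / 2) (by linarith)).trans ?_
  have hsq : (fun w : ℂ => w * w) =O[stripEnds a b] fun w => Real.exp (-(α / 2) * |w.re|) :=
    id.mul id _ (by linarith)
  refine (hsq.inv_rev ?_).congr (fun w => ?_) fun w => ?_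
  · filter_upwards [(eventually_ne_cobounded 0).filter_mono (stripEnds_le_cobounded a b)]
      with w hw h
    exact absurd (mul_self_eq_zero.1 h) hw
  · rw [← Real.exp_neg, neg_mul, neg_neg]
  · rw [mul_inv, sq]

section Gamma

variable {u : ℂ → ℂ} {c p : ℂ}

theorem eventually_one_le_abs_im (hc : c ≠ 0) (hre : c.re = 0) (hu : ∀ w, u w = c * (w - p)) :
    ∀ᶠ w in stripEnds a b, 1 ≤ |(u w).im| := by
  obtain ⟨L, hL⟩ := exists_abs_im_le a b
  have him : 0 < |c.im| := abs_pos.2 fun h => hc (Complex.ext hre h)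
  filter_upwards [eventually_stripEnds_mem a b, (stripEnds_le_cobounded a b)
    (tendsto_norm_cobounded_atTop.eventually_ge_atTop (L + |p.re| + |c.im|⁻¹))] with w hw hwL
  have hsub : |c.im|⁻¹ ≤ |w.re - p.re| := by
    linarith [hL w hw, norm_le_abs_re_add_abs_im w, abs_sub_abs_le_abs_sub w.re p.re]
  rw [hu, mul_im, hre, zero_mul, zero_add, abs_mul, sub_re]
  exact (inv_le_iff_one_le_mul₀' him).1 hsub

theorem exists_abs_re_le (hre : c.re = 0) (hu : ∀ w, u w = c * (w - p)) :
    ∃ B, ∀ w ∈ im ⁻¹' Ioo a b, |(u w).re| ≤ B := by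
  obtain ⟨L, hL⟩ := exists_abs_im_le a b
  refine ⟨|c.im| * (L + |p.im|), fun w hw => ?_⟩
  rw [hu, mul_re, hre, zero_mul, zero_sub, abs_neg, abs_mul, sub_im]
  have := hL w hw
  have := abs_sub w.im p.im
  gcongr
  linarith

theorem isBigO_Gamma_add_natCast (hc : c ≠ 0) (hre : c.re = 0) (hu : ∀ w, u w = c * (w - p))
    (n : ℕ) : (fun w => Gamma (u w)) =O[stripEnds a b] fun w => Gamma (u w + n) := by
  induction n with
  | zero => simpa using isBigO_refl _ _
  | succ n ih =>
    refine ih.trans (.of_bound 1 ?_)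
    filter_upwards [eventually_one_le_abs_im hc hre hu] with w hw
    have hone : 1 ≤ ‖u w + n‖ := by
      simpa using hw.trans ((congrArg _ (by simp)).trans_le (abs_im_le_norm (u w + n)))
    rw [Nat.cast_succ, ← add_assoc, Gamma_add_one _ (norm_pos_iff.1 (one_pos.trans_le hone)),
      norm_mul, one_mul]
    exact le_mul_of_one_le_left (norm_nonneg _) hone

theorem Gamma_comp (hc : c ≠ 0) (hre : c.re = 0) (hu : ∀ w, u w = c * (w - p)) :
    HasExpType a b (-(Real.pi / 2 * |c.im|)) fun w => Gamma (u w) := by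
  intro β hβ
  have him : 0 < |c.im| := abs_pos.2 fun h => hc (Complex.ext hre h)
  have hθ : -β / |c.im| < Real.pi / 2 := by
    rw [div_lt_iff₀ him]
    linarith
  obtain ⟨B, hB⟩ := exists_abs_re_le (a := a) (b := b) hre hu
  obtain ⟨n, hn⟩ := exists_nat_gt B
  obtain ⟨C, hC⟩ := exists_norm_Gamma_le (b := n + B) (sub_pos.2 hn) hθ
  refine (isBigO_Gamma_add_natCast hc hre hu n).trans (.of_bound (|C| * Real.exp |β * p.re|) ?_)
  filter_upwards [eventually_stripEnds_mem a b] with w hw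
  have hmem : (u w + n).re ∈ Icc (n - B) (n + B) := by
    rw [add_re, natCast_re]
    constructor <;> linarith [abs_le.1 (hB w hw)]
  have hexp : -(-β / |c.im| * |(u w + n).im|) = β * |w.re - p.re| := by
    rw [add_im, natCast_im, add_zero, hu, mul_im, hre, zero_mul, zero_add, sub_re, abs_mul]
    field_simp
  have hsub : β * |w.re - p.re| ≤ |β * p.re| + β * |w.re| := by
    have := abs_le.1 (abs_abs_sub_abs_le (w.re - p.re) w.re)
    rw [sub_sub_cancel_left, abs_neg] at this
    rw [abs_mul]
    rcases abs_cases β with ⟨h, _⟩ | ⟨h, _⟩ <;> rw [h] <;> nlinarith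
  refine (hC _ hmem).trans ?_
  rw [hexp, Real.norm_of_nonneg (Real.exp_pos _).le, mul_assoc, ← Real.exp_add]
  gcongr
  exact le_abs_self C

theorem sin_comp (hu : ∀ w, u w = c * (w - p)) :
    HasExpType a b (Real.pi * |c.im|) fun w => sin (Real.pi * u w) := by
  have hexp (ε : ℝ) (hε : |ε| = 1) :
      HasExpType a b (Real.pi * |c.im|) fun w => exp (ε * (Real.pi * u w) * I) := by
    have hre : |(ε * Real.pi * c * I).re| = Real.pi * |c.im| := by
      rw [← ofReal_mul, mul_I_re, im_ofReal_mul, abs_neg, abs_mul, abs_mul, hε, one_mul,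
        abs_of_pos Real.pi_pos]
    rw [← hre]
    convert! exp_mul_add (ε * Real.pi * c * I) (-(ε * Real.pi * c * I * p)) using 3
    rw [hu]
    ring
  have hadd := ((hexp (-1) (by simp)).mul (const (I / 2))).add
    ((hexp 1 (by simp)).mul (const (-I / 2)))
  rw [add_zero] at hadd
  refine hadd.congr (.of_forall fun w => ?_)
  have htwo := two_sin (Real.pi * u w)
  push_cast
  rw [neg_one_mul, one_mul]
  linear_combination (-1 / 2 : ℂ) * htwo

theorem inv_Gamma_comp (hc : c ≠ 0) (hre : c.re = 0) (hu : ∀ w, u w = c * (w - p)) :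
    HasExpType a b (Real.pi / 2 * |c.im|) fun w => (Gamma (u w))⁻¹ := by
  have hcompl : HasExpType a b (-(Real.pi / 2 * |c.im|)) fun w => Gamma (1 - u w) := by
    simpa using Gamma_comp (u := fun w => 1 - u w) (p := p + 1 / c) (neg_ne_zero.2 hc) (by simpa)
      fun w => by rw [hu]; field_simp; ring
  have hmul := (hcompl.mul (sin_comp hu)).mul (const (Real.pi : ℂ)⁻¹)
  rw [show -(Real.pi / 2 * |c.im|) + Real.pi * |c.im| + 0 = Real.pi / 2 * |c.im| by ring] at hmul
  refine hmul.congr ?_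
  filter_upwards [eventually_one_le_abs_im hc hre hu] with w hw
  have hint (n : ℤ) : u w ≠ n := fun h => by
    rw [h, intCast_im, abs_zero] at hw
    exact one_pos.not_ge hw
  have hGamma : Gamma (u w) ≠ 0 := Gamma_ne_zero fun m => by simpa using hint (-m)
  have hrefl := Gamma_mul_Gamma_one_sub (u w)
  have hsin : sin (Real.pi * u w) ≠ 0 := fun h => by
    obtain ⟨k, hk⟩ := sin_eq_zero_iff.1 h
    exact hint k (mul_right_cancel₀ (ofReal_ne_zero.2 Real.pi_ne_zero) (by rw [← hk]; ring))
  rw [eq_div_iff hsin] at hrefl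
  have hpi : (Real.pi : ℂ) ≠ 0 := ofReal_ne_zero.2 Real.pi_ne_zero
  rw [← div_eq_mul_inv, div_eq_iff hpi, eq_inv_mul_iff_mul_eq₀ hGamma, ← mul_assoc, hrefl]

end Gamma

theorem dslope (hf : HasExpType a b 0 f) (p : ℂ) : HasExpType a b 0 (_root_.dslope f p) := by
  have hinv : HasExpType a b 0 fun w => (w - p)⁻¹ := of_isBigO_one <|
    ((isBigO_inv_sub p).mono (stripEnds_le_cobounded a b)).trans
      (((tendsto_inv₀_cobounded (α := ℂ)).mono_left (stripEnds_le_cobounded a b)).isBigO_one ℝ)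
  have hsub := hinv.mul (hf.add (const (-f p)))
  rw [add_zero] at hsub
  refine hsub.congr ?_
  filter_upwards [(eventually_ne_cobounded p).filter_mono (stripEnds_le_cobounded a b)] with w hw
  rw [dslope_of_ne _ hw, slope_def_field, div_eq_inv_mul, sub_eq_add_neg (f w)]

end HasExpType

section Andreief

variable {ι R α 𝕜 : Type*} [Fintype ι] [DecidableEq ι] [CommRing R] [MeasurableSpace α]
  {μ : Measure α} [SigmaFinite μ] [RCLike 𝕜] {f g : ι → α → 𝕜}

theorem det_mul_det_eq_sum_prod (A B : Matrix ι ι R) :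
    A.det * B.det = ∑ σ : Equiv.Perm ι, ∑ τ : Equiv.Perm ι,
      ((Equiv.Perm.sign σ : ℤ) * (Equiv.Perm.sign τ : ℤ) : R) * ∏ a, A (σ a) a * B (τ a) a := by
  simp only [Matrix.det_apply', Finset.sum_mul_sum, Finset.prod_mul_distrib, mul_mul_mul_comm]

theorem sum_sign_mul_prod_eq_det (A : Matrix ι ι R) (σ : Equiv.Perm ι) :
    ∑ τ : Equiv.Perm ι, ((Equiv.Perm.sign σ : ℤ) * (Equiv.Perm.sign τ : ℤ) : R) *
      ∏ a, A (σ a) (τ a) = A.det := by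
  have hprod (τ : Equiv.Perm ι) : ∏ a, A (σ a) (τ a) = ∏ a, A a ((τ * σ⁻¹) a) := by
    rw [← Equiv.prod_comp σ fun a => A a ((τ * σ⁻¹) a)]
    simp
  rw [← Matrix.det_transpose, Matrix.det_apply']
  refine Fintype.sum_equiv (Equiv.mulRight σ⁻¹) _ _ fun τ => ?_
  simp only [hprod, Equiv.coe_mulRight, Matrix.transpose_apply, Equiv.Perm.sign_mul,
    Equiv.Perm.sign_inv, Units.val_mul, Int.cast_mul, mul_comm]

omit [DecidableEq ι] in
theorem integrable_const_mul_prod (h : ∀ i j, Integrable (fun t => f i t * g j t) μ)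
    (c : 𝕜) (σ τ : ι → ι) :
    Integrable (fun t : ι → α => c * ∏ a, f (σ a) (t a) * g (τ a) (t a)) (.pi fun _ => μ) :=
  (Integrable.fintype_prod (f := fun a t => f (σ a) t * g (τ a) t) fun a =>
    h (σ a) (τ a)).const_mul c

theorem integrable_det_mul_det (h : ∀ i j, Integrable (fun t => f i t * g j t) μ) :
    Integrable (fun t : ι → α => (Matrix.of fun i a => f i (t a)).det *
      (Matrix.of fun j a => g j (t a)).det) (.pi fun _ => μ) := by
  simp only [det_mul_det_eq_sum_prod, Matrix.of_apply]
  exact integrable_finsetSum _ fun σ _ => integrable_finsetSum _ fun τ _ =>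
    integrable_const_mul_prod h _ σ τ

theorem integral_det_mul_det (h : ∀ i j, Integrable (fun t => f i t * g j t) μ) :
    ∫ t : ι → α, (Matrix.of fun i a => f i (t a)).det * (Matrix.of fun j a => g j (t a)).det
        ∂(Measure.pi fun _ => μ) =
      (Fintype.card ι).factorial * (Matrix.of fun i j => ∫ t, f i t * g j t ∂μ).det := by
  have hterm (σ τ : Equiv.Perm ι) := integrable_const_mul_prod h
    ((Equiv.Perm.sign σ : ℤ) * (Equiv.Perm.sign τ : ℤ) : 𝕜) σ τ
  simp only [det_mul_det_eq_sum_prod, Matrix.of_apply]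
  rw [integral_finsetSum _ fun σ _ => integrable_finsetSum _ fun τ _ => hterm σ τ]
  calc ∑ σ : Equiv.Perm ι, ∫ t : ι → α, ∑ τ : Equiv.Perm ι,
          ((Equiv.Perm.sign σ : ℤ) * (Equiv.Perm.sign τ : ℤ) : 𝕜) *
            ∏ a, f (σ a) (t a) * g (τ a) (t a) ∂(Measure.pi fun _ => μ)
      = ∑ _σ : Equiv.Perm ι, (Matrix.of fun i j => ∫ t, f i t * g j t ∂μ).det := by
        refine Finset.sum_congr rfl fun σ _ => ?_
        rw [integral_finsetSum _ fun τ _ => hterm σ τ, ← sum_sign_mul_prod_eq_det _ σ]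
        refine Finset.sum_congr rfl fun τ _ => ?_
        rw [integral_const_mul, integral_fintype_prod_eq_prod (μ := fun _ => μ)
          fun a t => f (σ a) t * g (τ a) t]
        simp only [Matrix.of_apply]
    _ = _ := by
        rw [Finset.sum_const, Finset.card_univ, Fintype.card_perm, nsmul_eq_mul]

end Andreief

section Vandermonde

variable {n : ℕ}

/-- The exponentials `exp (π (2k - (n - 1)) w)`, `0 ≤ k < n`, which span the products of `n - 1`
hyperbolic sines of `π (w - wⱼ)`. -/
noncomputable def centeredExp (n k : ℕ) (w : ℂ) : ℂ :=
  exp (Real.pi * (2 * k - (n - 1)) * w)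

/-- The hyperbolic analogue `∏ (i < j), sinh (π (wⱼ - wᵢ)) / π` of the Vandermonde determinant. -/
noncomputable def sinhVandermonde (w : Fin n → ℂ) : ℂ :=
  ∏ i, ∏ j ∈ Finset.Ioi i, sinh (Real.pi * (w j - w i)) / Real.pi

theorem prod_offDiag_eq_prod_Ioi {M : Type*} [CommMonoid M] (F : Fin n → Fin n → M) :
    ∏ p ∈ (Finset.univ : Finset (Fin n)).offDiag, F p.1 p.2 =
      ∏ i, ∏ j ∈ Finset.Ioi i, F i j * F j i := by
  rw [Finset.prod_prod_Ioi_mul_eq_prod_prod_off_diag fun i j => F j i, Finset.prod_sigma']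
  exact Finset.prod_nbij' (fun p => ⟨p.1, p.2⟩) (fun q => (q.1, q.2))
    (by simp [eq_comm]) (by simp [eq_comm]) (by simp) (by simp) (by simp)

theorem prod_Ioi_mul_eq_prod_pow {M : Type*} [CommMonoid M] (c : Fin n → M) :
    ∏ i, ∏ j ∈ Finset.Ioi i, c i * c j = ∏ i, c i ^ (n - 1) := by
  rw [Finset.prod_prod_Ioi_mul_eq_prod_prod_off_diag fun _ j => c j]
  simp [Finset.card_compl]

theorem prod_Ioi_const_eq_pow_choose {M : Type*} [CommMonoid M] (n : ℕ) (c : M) :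
    ∏ i : Fin n, ∏ _j ∈ Finset.Ioi i, c = c ^ n.choose 2 := by
  simp only [Finset.prod_const, Fin.card_Ioi, Finset.prod_pow_eq_pow_sum,
    Fin.sum_univ_eq_sum_range fun i => n - 1 - i, Finset.sum_range_reflect (fun i => i),
    Finset.sum_range_id, Nat.choose_two_right]

theorem sinhVandermonde_eq_det (w : Fin n → ℂ) :
    (2 * Real.pi : ℂ) ^ n.choose 2 * sinhVandermonde w =
      (Matrix.of fun k a : Fin n => centeredExp n k (w a)).det := by
  set u : Fin n → ℂ := fun a => exp (2 * (Real.pi * w a)) with hu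
  set c : Fin n → ℂ := fun a => exp (-(Real.pi * w a)) with hc
  have hsinh (i j : Fin n) :
      2 * Real.pi * (sinh (Real.pi * (w j - w i)) / Real.pi) = c i * c j * (u j - u i) := by
    rw [mul_assoc, mul_div_cancel₀ _ (ofReal_ne_zero.2 Real.pi_ne_zero), two_sinh]
    simp only [hc, hu, mul_sub, ← exp_add]
    ring_nf
  have hcol : (Matrix.of fun k a : Fin n => centeredExp n k (w a)) =
      Matrix.of fun k a => c a ^ (n - 1) * (Matrix.vandermonde u).transpose k a := by
    ext k a
    have hn : ((n - 1 : ℕ) : ℂ) = n - 1 := by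
      rw [Nat.cast_sub (by have := a.2; omega), Nat.cast_one]
    simp only [Matrix.transpose_apply, Matrix.of_apply, Matrix.vandermonde_apply, centeredExp, hc,
      hu, ← exp_nat_mul, ← exp_add, hn]
    ring_nf
  rw [hcol, Matrix.det_mul_row, Matrix.det_transpose, Matrix.det_vandermonde,
    ← prod_Ioi_mul_eq_prod_pow, ← prod_Ioi_const_eq_pow_choose, sinhVandermonde]
  simp only [← Finset.prod_mul_distrib, hsinh]

theorem inv_Gamma_mul_Gamma_neg (u : ℂ) :
    (Gamma u * Gamma (-u))⁻¹ = -u * (sin (Real.pi * u) / Real.pi) := by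
  rcases eq_or_ne u 0 with rfl | hu
  · simp
  have hrefl := Gamma_mul_Gamma_one_sub u
  rw [sub_eq_neg_add, Gamma_add_one _ (neg_ne_zero.2 hu), mul_left_comm] at hrefl
  rw [← inv_div, ← hrefl, mul_inv (-u), mul_inv_cancel_left₀ (neg_ne_zero.2 hu)]

theorem inv_prod_offDiag_Gamma (w : Fin n → ℂ) :
    (∏ p ∈ (Finset.univ : Finset (Fin n)).offDiag, Gamma ((w p.1 - w p.2) / I))⁻¹ =
      (Matrix.vandermonde w).det * sinhVandermonde w := by
  simp only [prod_offDiag_eq_prod_Ioi fun i j => Gamma ((w i - w j) / I),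
    Matrix.det_vandermonde, sinhVandermonde, ← Finset.prod_inv_distrib, ← Finset.prod_mul_distrib]
  refine Finset.prod_congr rfl fun i _ => Finset.prod_congr rfl fun j _ => ?_
  have hinv := inv_Gamma_mul_Gamma_neg ((w i - w j) / I)
  have hsin : sin (Real.pi * ((w i - w j) / I)) = sinh (Real.pi * (w j - w i)) * I := by
    rw [← sin_mul_I, div_I]
    ring_nf
  rw [← neg_div, neg_sub] at hinv
  rw [hinv, hsin]
  field_simp

end Vandermonde

section MomentDet

open Polynomial

variable {R : Type*} [CommRing R] {n m : ℕ}

theorem det_apply_eq_prod_coeff_mul_det_apply_X_pow (L : R[X] →ₗ[R] Fin n → R) {p : Fin n → R[X]}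
    (hp : ∀ j, (p j).natDegree ≤ j) :
    (Matrix.of fun j => L (p j)).det =
      (∏ j, (p j).coeff j) * (Matrix.of fun j : Fin n => L (X ^ (j : ℕ))).det := by
  have hmul : (Matrix.of fun j => L (p j)) =
      (Matrix.of fun j i : Fin n => (p j).coeff i) *
        Matrix.of fun j : Fin n => L (X ^ (j : ℕ)) := by
    ext j k
    have hsum := congrFun (congrArg L (p j).as_sum_range_C_mul_X_pow) k
    rw [Finset.sum_subset (Finset.range_subset_range.2 (by have := hp j; omega : _ ≤ n))
      fun i _ hi => by
        rw [coeff_eq_zero_of_natDegree_lt (by simpa [Nat.lt_succ_iff] using hi), C_0, zero_mul],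
      ← Fin.sum_univ_eq_sum_range fun i => C ((p j).coeff i) * X ^ i] at hsum
    simpa [Matrix.mul_apply, ← smul_eq_C_mul] using hsum
  rw [hmul, Matrix.det_mul, Matrix.det_of_isLowerTriangular]
  · rfl
  · exact fun j i hij => coeff_eq_zero_of_natDegree_lt ((hp j).trans_lt hij)

/-- The determinant of the moments `L (X ^ j)`, `0 ≤ j < n`, of a family `L` of `n` linear
functionals on polynomials. -/
noncomputable def momentDet (L : R[X] →ₗ[R] Fin n → R) : R :=
  (Matrix.of fun j : Fin n => L (X ^ (j : ℕ))).det

theorem det_monic_eq_momentDet (L : R[X] →ₗ[R] Fin n → R) {p : Fin n → R[X]}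
    (hp : ∀ j, (p j).natDegree = j) (hmonic : ∀ j, (p j).Monic) :
    (Matrix.of fun j => L (p j)).det = momentDet L := by
  rw [det_apply_eq_prod_coeff_mul_det_apply_X_pow L fun j => (hp j).le,
    Finset.prod_eq_one fun j _ => by rw [← hp j]; exact hmonic j, one_mul, momentDet]

theorem det_updateRow_last_eq_coeff_mul_momentDet (L : R[X] →ₗ[R] Fin (m + 1) → R) {q : R[X]}
    (hq : q.natDegree ≤ m) :
    ((Matrix.of fun j : Fin (m + 1) => L (X ^ (j : ℕ))).updateRow (Fin.last m) (L q)).det =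
      q.coeff m * momentDet L := by
  set p : Fin (m + 1) → R[X] := Function.update (fun j => X ^ (j : ℕ)) (Fin.last m) q
  have hlast : p (Fin.last m) = q := Function.update_self ..
  have hne (j) (hj : j ≠ Fin.last m) : p j = X ^ (j : ℕ) := Function.update_of_ne hj ..
  have hmat : (Matrix.of fun j : Fin (m + 1) => L (X ^ (j : ℕ))).updateRow (Fin.last m) (L q) =
      Matrix.of fun j => L (p j) := by
    ext j k
    rcases eq_or_ne j (Fin.last m) with rfl | hj
    · simp [hlast]
    · simp [hne j hj, Matrix.updateRow_ne hj]
  have hdeg (j) : (p j).natDegree ≤ j := by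
    rcases eq_or_ne j (Fin.last m) with rfl | hj
    · simpa [hlast] using hq
    · rw [hne j hj]
      exact natDegree_X_pow_le _
  rw [hmat, det_apply_eq_prod_coeff_mul_det_apply_X_pow L hdeg, ← momentDet,
    Fintype.prod_eq_single (Fin.last m) fun j hj => by rw [hne j hj, coeff_X_pow_self], hlast,
    Fin.val_last]

theorem det_snoc_eq_det_cons (A : Fin m → Fin (m + 1) → R) (v : Fin (m + 1) → R) :
    (Matrix.of (Fin.snoc A v : Fin (m + 1) → Fin (m + 1) → R)).det =
      (-1) ^ m * (Matrix.of (Fin.cons v A : Fin (m + 1) → Fin (m + 1) → R)).det := by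
  have hrot : Matrix.of (Fin.snoc A v : Fin (m + 1) → Fin (m + 1) → R) =
      (Matrix.of (Fin.cons v A : Fin (m + 1) → Fin (m + 1) → R)).submatrix
        (finRotate (m + 1)) id := by
    ext i k
    rw [Fin.snoc_eq_cons_rotate]
    rfl
  rw [hrot, Matrix.det_permute, sign_finRotate]
  simp

theorem det_snoc_mul_X_sub_C_eq_momentDet [Nontrivial R] (L : R[X] →ₗ[R] Fin (m + 1) → R) (a : R) :
    (Matrix.of (Fin.snoc (fun j : Fin m => L ((X - C a) * X ^ (j : ℕ))) (L 1) :
      Fin (m + 1) → Fin (m + 1) → R)).det = (-1) ^ m * momentDet L := by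
  let p : Fin (m + 1) → R[X] := Fin.cons 1 fun j : Fin m => (X - C a) * X ^ (j : ℕ)
  have hmonic (j : Fin m) : ((X - C a) * X ^ (j : ℕ)).Monic :=
    (monic_X_sub_C a).mul (monic_X_pow _)
  have hcons : (Fin.cons (L 1) fun j : Fin m => L ((X - C a) * X ^ (j : ℕ)) :
      Fin (m + 1) → Fin (m + 1) → R) = fun j => L (p j) := by
    funext j
    cases j using Fin.cases <;> rfl
  rw [det_snoc_eq_det_cons, hcons, det_monic_eq_momentDet L (p := p)]
  · intro j
    cases j using Fin.cases with
    | zero => simp [p]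
    | succ j =>
      simp [p, (monic_X_sub_C a).natDegree_mul (monic_X_pow _), add_comm]
  · intro j
    cases j using Fin.cases with
    | zero => exact monic_one
    | succ j => exact hmonic j

theorem momentDet_comp_mulLeft_X_sub_C [Nontrivial R] (L : R[X] →ₗ[R] Fin (m + 1) → R) (a c : R)
    {Y Q : R[X]} (hY : Y.Monic) (hYdeg : Y.natDegree = m + 1) (hQ : Q.degree < m)
    (hL : L Y = c • L ((X - C a) * Q)) :
    momentDet (L ∘ₗ LinearMap.mulLeft R (X - C a)) = (-1) ^ (m + 1) * Y.eval a * momentDet L := by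
  set L' := L ∘ₗ LinearMap.mulLeft R (X - C a)
  set q := Y /ₘ (X - C a) - c • Q with hq
  have hquot : (Y /ₘ (X - C a)).natDegree = m := by
    rw [natDegree_divByMonic _ (monic_X_sub_C a), hYdeg, natDegree_X_sub_C, Nat.add_sub_cancel]
  have hcQ : (c • Q).degree < m := (degree_smul_le c Q).trans_lt hQ
  have hdeg : q.natDegree ≤ m :=
    (natDegree_sub_le _ _).trans (max_le hquot.le (natDegree_le_of_degree_le hcQ.le))
  have hcoeff : q.coeff m = 1 := by
    have hdegle : (X - C a).degree ≤ Y.degree := by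
      rw [degree_X_sub_C, degree_eq_natDegree hY.ne_zero, hYdeg]
      exact mod_cast Nat.le_add_left 1 m
    have hlead := leadingCoeff_divByMonic_of_monic (monic_X_sub_C a) hdegle
    rwa [leadingCoeff, hquot, hY.leadingCoeff, ← sub_zero (coeff _ m),
      ← coeff_eq_zero_of_degree_lt hcQ, ← coeff_sub] at hlead
  have hLq : L' q = -Y.eval a • L 1 := by
    have hmul : (X - C a) * q = Y - C (Y.eval a) * 1 - c • ((X - C a) * Q) := by
      linear_combination (norm := (simp only [smul_eq_C_mul]; ring))
        (X - C a) * hq + modByMonic_add_div Y (X - C a) - modByMonic_X_sub_C_eq_C_eval Y a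
    rw [LinearMap.comp_apply, LinearMap.mulLeft_apply, hmul, ← smul_eq_C_mul, map_sub, map_sub, hL,
      map_smul, map_smul]
    module
  have hrow : (Matrix.of fun j : Fin (m + 1) => L' (X ^ (j : ℕ))).updateRow (Fin.last m) (L 1) =
      Matrix.of (Fin.snoc (fun j : Fin m => L ((X - C a) * X ^ (j : ℕ))) (L 1)) := by
    ext j k
    cases j using Fin.lastCases <;> simp [L', Matrix.updateRow_apply, (Fin.castSucc_lt_last _).ne]
  have hdet := det_updateRow_last_eq_coeff_mul_momentDet L' hdeg
  rw [hLq, Matrix.det_updateRow_smul, hrow, det_snoc_mul_X_sub_C_eq_momentDet, hcoeff,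
    one_mul] at hdet
  rw [← hdet]
  ring

theorem hasDerivAt_det {ι 𝕜 A : Type*} [Fintype ι] [DecidableEq ι] [NontriviallyNormedField 𝕜]
    [NormedCommRing A] [NormedAlgebra 𝕜 A] {M : 𝕜 → Matrix ι ι A} {M' : Matrix ι ι A} {s : 𝕜}
    (h : ∀ i, HasDerivAt (fun s => M s i) (M' i) s) :
    HasDerivAt (fun s => (M s).det) (∑ i, ((M s).updateRow i (M' i)).det) s := by
  let det : ContinuousMultilinearMap 𝕜 (fun _ : ι => ι → A) A :=
    { (Matrix.detRowAlternating (n := ι) (R := A)).toMultilinearMap.restrictScalars 𝕜 with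
      cont := Continuous.matrix_det continuous_id }
  refine (HasFDerivAt.multilinear_comp det fun i => (h i).hasFDerivAt).hasDerivAt.congr_deriv ?_
  simp only [_root_.sum_apply, ContinuousLinearMap.comp_apply,
    ContinuousLinearMap.toSpanSingleton_apply_one]
  rfl

theorem hasDerivAt_momentDet {𝕜 A : Type*} [NontriviallyNormedField 𝕜] [NormedCommRing A]
    [NormedAlgebra 𝕜 A] {L : 𝕜 → A[X] →ₗ[A] Fin (m + 1) → A} {d : A} {s : 𝕜} {q : A[X]}
    (hL : ∀ p, HasDerivAt (fun s => L s p) (d • L s (X * p)) s) (hq : q.natDegree ≤ m)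
    (hLq : L s (X ^ (m + 1)) = L s q) :
    HasDerivAt (fun s => momentDet (L s)) (d * q.coeff m * momentDet (L s)) s := by
  let M (s : 𝕜) : Matrix (Fin (m + 1)) (Fin (m + 1)) A := Matrix.of fun j => L s (X ^ (j : ℕ))
  have hrow (j : Fin (m + 1)) (hj : j ≠ Fin.last m) :
      ((M s).updateRow j (d • L s (X * X ^ (j : ℕ)))).det = 0 := by
    obtain ⟨i, rfl⟩ := Fin.exists_castSucc_eq.2 hj
    rw [Matrix.det_updateRow_smul, Matrix.det_zero_of_row_eq (i := i.castSucc) (j := i.succ)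
      i.castSucc_lt_succ.ne, mul_zero]
    rw [Matrix.updateRow_self, Matrix.updateRow_ne i.castSucc_lt_succ.ne', ← pow_succ']
    rfl
  refine (hasDerivAt_det (M := M) (M' := fun j => d • L s (X * X ^ (j : ℕ)))
    fun j => hL _).congr_deriv ?_
  rw [Fintype.sum_eq_single (Fin.last m) hrow, Matrix.det_updateRow_smul, Fin.val_last,
    ← pow_succ', hLq, det_updateRow_last_eq_coeff_mul_momentDet _ hq, mul_assoc]

end MomentDet

section BarnesWeight

variable {n m : ℕ} {a b s : ℝ} {y : Fin n → ℂ} {x : Fin m → ℂ} {w : ℂ}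

/-- The weight of the one-dimensional Mellin–Barnes integrals whose determinant is the multiple
integral, for `ℏ = 1`. -/
noncomputable def barnesWeight (s : ℝ) (y : Fin n → ℂ) (x : Fin m → ℂ) (w : ℂ) : ℂ :=
  exp (s * w / I) * ((∏ b, Gamma ((y b - w) / I)) * ∏ b, Gamma ((w - x b) / I))

/-- The points at which some factor of `barnesWeight s y x` has a pole. -/
def barnesPoles (y : Fin n → ℂ) (x : Fin m → ℂ) : Set ℂ :=
  {p | (∃ b, ∃ k : ℕ, p = y b + I * k) ∨ ∃ b, ∃ k : ℕ, p = x b - I * k}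

theorem MeromorphicOnStrip.barnesWeight (s : ℝ) (y : Fin n → ℂ) (x : Fin m → ℂ) :
    MeromorphicOnStrip a b (barnesPoles y x) (barnesWeight s y x) := by
  refine .mul (.of_differentiable (by fun_prop)) (.mul (.prod fun i _ => ?_) (.prod fun i _ => ?_))
  · have hu (w : ℂ) : (y i - w) / I = I * (w - y i) := by rw [div_I]; ring
    refine .Gamma_comp I_ne_zero hu ?_ fun k => .inl ⟨i, k, by rw [div_I]; ring⟩
    obtain ⟨B, hB⟩ := HasExpType.exists_abs_re_le (a := a) (b := b) I_re hu
    exact ⟨-B - 1, fun w hw => by linarith [neg_le_of_abs_le (hB w hw)]⟩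
  · have hu (w : ℂ) : (w - x i) / I = -I * (w - x i) := by rw [div_I]; ring
    refine .Gamma_comp (neg_ne_zero.2 I_ne_zero) hu ?_ fun k =>
      .inr ⟨i, k, by rw [div_neg, div_I]; ring⟩
    obtain ⟨B, hB⟩ := HasExpType.exists_abs_re_le (a := a) (b := b) (by simp) hu
    exact ⟨-B - 1, fun w hw => by linarith [neg_le_of_abs_le (hB w hw)]⟩

theorem HasExpType.barnesWeight (s : ℝ) (y : Fin n → ℂ) (x : Fin m → ℂ) :
    HasExpType a b (-(Real.pi / 2 * (n + m))) (barnesWeight s y x) := by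
  have hexp : HasExpType a b 0 fun w : ℂ => exp (s * w / I) := by
    simpa [div_I, mul_right_comm] using exp_mul_add (a := a) (b := b) (-(s * I)) 0
  have hy := prod (a := a) (b := b) (s := Finset.univ) (F := fun b w => Gamma ((y b - w) / I))
    fun i _ => Gamma_comp (p := y i) I_ne_zero I_re fun w => by rw [div_I]; ring
  have hx := prod (a := a) (b := b) (s := Finset.univ) (F := fun b w => Gamma ((w - x b) / I))
    fun i _ => Gamma_comp (c := -I) (p := x i) (by simp) (by simp) fun w => by rw [div_I]; ring
  convert! hexp.mul (hy.mul hx) using 1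
  simp only [I_im, neg_im, abs_neg, abs_one, mul_one, Finset.sum_const, Finset.card_univ,
    Fintype.card_fin, nsmul_eq_mul, zero_add]
  ring

theorem barnesWeight_add_I (s : ℝ) (y : Fin n → ℂ) (x : Fin m → ℂ) (w : ℂ) :
    barnesWeight s (fun b => y b + I) x (w + I) =
      exp s * barnesWeight s y (fun b => x b - I) w := by
  simp only [barnesWeight, add_sub_add_right_eq_sub, sub_sub_eq_add_sub, ← mul_assoc, ← exp_add]
  congr 3
  rw [mul_add, add_div, mul_div_cancel_right₀ _ I_ne_zero, add_comm]

theorem barnesWeight_left_add_I (hw : ∀ b, w ≠ y b) :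
    (∏ b, (w - y b)) * barnesWeight s y x w =
      (-I) ^ n * barnesWeight s (fun b => y b + I) x w := by
  have hGamma (b) : Gamma ((y b + I - w) / I) = I * (w - y b) * Gamma ((y b - w) / I) := by
    rw [add_sub_right_comm, add_div, div_self I_ne_zero,
      Gamma_add_one _ (div_ne_zero (sub_ne_zero.2 (hw b).symm) I_ne_zero), div_I]
    ring
  have hpow : (-I) ^ n * I ^ n = 1 := by rw [← mul_pow]; simp
  simp only [barnesWeight, hGamma, Finset.prod_mul_distrib, Finset.prod_const, Finset.card_univ,
    Fintype.card_fin]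
  linear_combination (-(∏ b, (w - y b)) * exp (s * w / I) * (∏ b, Gamma ((y b - w) / I)) *
    ∏ b, Gamma ((w - x b) / I)) * hpow

theorem barnesWeight_piecewise_sub_I (S : Finset (Fin m)) (hw : ∀ b ∈ S, w ≠ x b) :
    barnesWeight s y (S.piecewise (fun b => x b - I) x) w =
      (-I) ^ S.card * ((∏ b ∈ S, (w - x b)) * barnesWeight s y x w) := by
  have hGamma (b) : Gamma ((w - S.piecewise (fun b => x b - I) x b) / I) =
      (if b ∈ S then -I * (w - x b) else 1) * Gamma ((w - x b) / I) := by
    by_cases hb : b ∈ S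
    · rw [S.piecewise_eq_of_mem _ _ hb, if_pos hb, sub_sub_eq_add_sub, add_sub_right_comm, add_div,
        div_self I_ne_zero,
        Gamma_add_one _ (div_ne_zero (sub_ne_zero.2 (hw b hb)) I_ne_zero), div_I]
      ring
    · rw [S.piecewise_eq_of_notMem _ _ hb, if_neg hb, one_mul]
  simp only [barnesWeight, hGamma, Finset.prod_mul_distrib, Finset.prod_ite_mem, Finset.univ_inter,
    Finset.prod_const]
  ring

theorem centeredExp_succ_add_I (m k : ℕ) (w : ℂ) :
    centeredExp (m + 1) k (w + I) = (-1) ^ m * centeredExp (m + 1) k w := by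
  have hneg : ((-1 : ℂ)) ^ m = exp (k * (2 * Real.pi * I) + -(m * (Real.pi * I))) := by
    rw [exp_add, exp_nat_mul_two_pi_mul_I, one_mul, ← mul_neg, exp_nat_mul, exp_neg,
      exp_pi_mul_I, inv_neg_one]
  rw [centeredExp, centeredExp, hneg, ← exp_add]
  push_cast
  ring_nf

end BarnesWeight

/-- The contour `γ` passes below the poles of the factors `Γ ((y b - w) / I)` and above those of
the factors `Γ ((w - x b) / I)` of `barnesWeight s y x`. -/
structure SeparatesPoles {n m : ℕ} (γ : ℝ → ℂ) (y : Fin n → ℂ) (x : Fin m → ℂ) : Prop where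
  isStripContour : IsStripContour γ
  above : ∀ b (k : ℕ), LiesAbove γ (y b + I * k)
  below : ∀ b (k : ℕ), LiesBelow γ (x b - I * k)

namespace SeparatesPoles

variable {n m : ℕ} {γ γ' : ℝ → ℂ} {s : ℝ} {y : Fin n → ℂ} {x : Fin m → ℂ} {f : ℂ → ℂ} {α : ℝ}

theorem sameSide (h : SeparatesPoles γ y x) (h' : SeparatesPoles γ' y x) :
    ∀ p ∈ barnesPoles y x, SameSide γ γ' p := by
  rintro _ (⟨b, k, rfl⟩ | ⟨b, k, rfl⟩)
  · exact .inl ⟨h.above b k, h'.above b k⟩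
  · exact .inr ⟨h.below b k, h'.below b k⟩

theorem ne_left (h : SeparatesPoles γ y x) {w : ℂ} (hw : w ∈ range γ) (b : Fin n) : w ≠ y b :=
  ne_of_mem_of_not_mem hw (by simpa using (h.above b 0).notMem_range)

theorem ne_right (h : SeparatesPoles γ y x) {w : ℂ} (hw : w ∈ range γ) (b : Fin m) : w ≠ x b :=
  ne_of_mem_of_not_mem hw (by simpa using (h.below b 0).notMem_range)

theorem left_ne_right (h : SeparatesPoles γ y x) (a : Fin n) (b : Fin m) : y a ≠ x b := fun hab =>
  (h.above a 0).not_liesBelow h.isStripContour (by simpa [hab] using h.below b 0)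

theorem left_add_I (h : SeparatesPoles γ y x) : SeparatesPoles γ (fun b => y b + I) x where
  isStripContour := h.isStripContour
  above b k := by
    have := h.above b (k + 1)
    rwa [Nat.cast_succ, mul_add, mul_one, add_comm (I * _), ← add_assoc] at this
  below := h.below

theorem piecewise_sub_I (h : SeparatesPoles γ y x) (S : Finset (Fin m)) :
    SeparatesPoles γ y (S.piecewise (fun b => x b - I) x) where
  isStripContour := h.isStripContour
  above := h.above
  below b k := by
    by_cases hb : b ∈ S
    · have := h.below b (k + 1)
      rw [Nat.cast_succ, mul_add, mul_one, add_comm (I * _), ← sub_sub] at this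
      rwa [S.piecewise_eq_of_mem _ _ hb]
    · rw [S.piecewise_eq_of_notMem _ _ hb]
      exact h.below b k

theorem add_I (h : SeparatesPoles γ y fun b => x b - I) :
    SeparatesPoles (fun t => γ t + I) (fun b => y b + I) x where
  isStripContour := by simpa using h.isStripContour.mul_add_const one_pos I
  above b k := by simpa [add_right_comm] using (h.above b k).mul_add_const one_pos I
  below b k := by
    simpa [sub_right_comm _ I] using (h.below b k).mul_add_const one_pos I

theorem integrable_mul_barnesWeight (h : SeparatesPoles γ y x) (hf : Differentiable ℂ f)
    (hft : ∀ a b, HasExpType a b α f) (hα : α < Real.pi / 2 * (n + m)) :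
    Integrable fun t => f (γ t) * barnesWeight s y x (γ t) * deriv γ t := by
  obtain ⟨L, hL⟩ := h.isStripContour.exists_im_mem_Ioo
  exact (MeromorphicOnStrip.of_differentiable hf).mul (.barnesWeight s y x) |>.integrable
    h.isStripContour hL (fun p hp => (h.sameSide h p hp).notMem_range)
    (((hft _ _).mul (.barnesWeight s y x)).isBigO_inv_sq (by linarith))

theorem contourIntegral_mul_barnesWeight_eq (h : SeparatesPoles γ y x)
    (h' : SeparatesPoles γ' y x) (hf : Differentiable ℂ f) (hft : ∀ a b, HasExpType a b α f)
    (hα : α < Real.pi / 2 * (n + m)) :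
    contourIntegral γ (fun w => f w * barnesWeight s y x w) =
      contourIntegral γ' fun w => f w * barnesWeight s y x w := by
  obtain ⟨L, hL⟩ := h.isStripContour.exists_im_mem_Ioo
  obtain ⟨L', hL'⟩ := h'.isStripContour.exists_im_mem_Ioo
  have hmem {δ : ℝ → ℂ} {M} (hM : M ≤ max L L') (hδ : ∀ t, (δ t).im ∈ Ioo (-M) M) (t) :
      (δ t).im ∈ Ioo (-max L L') (max L L') :=
    Ioo_subset_Ioo (neg_le_neg hM) hM (hδ t)
  exact (MeromorphicOnStrip.of_differentiable hf).mul (.barnesWeight s y x) |>.contourIntegral_eq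
    h.isStripContour h'.isStripContour (hmem (le_max_left _ _) hL) (hmem (le_max_right _ _) hL')
    (h.sameSide h') (((hft _ _).mul (.barnesWeight s y x)).isBigO_inv_sq (by linarith))

/-- Substitute `w + I` for `w` and move the contour back: the only poles in the way are the points
`y b`, which are cancelled by the factors `w - y b`. -/
theorem contourIntegral_prod_sub_mul (h : SeparatesPoles γ y x) (hf : Differentiable ℂ f)
    (hft : ∀ a b, HasExpType a b α f) (hα : α < Real.pi / 2 * (n + m)) {c : ℂ}
    (hfI : ∀ w, f (w + I) = c * f w) :
    contourIntegral γ (fun w => (∏ b, (w - y b)) * f w * barnesWeight s y x w) =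
      (-I) ^ (n + m) * c * exp s *
        contourIntegral γ fun w => (∏ b, (w - x b)) * f w * barnesWeight s y x w := by
  have hx : SeparatesPoles γ y fun b => x b - I := by
    simpa only [Finset.piecewise_univ] using h.piecewise_sub_I Finset.univ
  calc contourIntegral γ (fun w => (∏ b, (w - y b)) * f w * barnesWeight s y x w)
      = (-I) ^ n *
          contourIntegral γ fun w => f w * barnesWeight s (fun b => y b + I) x w := by
        rw [← contourIntegral_const_mul]
        refine contourIntegral_congr fun w hw => ?_
        linear_combination f w * barnesWeight_left_add_I (s := s) (x := x) (h.ne_left hw)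
    _ = (-I) ^ n * contourIntegral γ fun w => c * exp s * (f w * barnesWeight s y
          (fun b => x b - I) w) := by
        rw [h.left_add_I.contourIntegral_mul_barnesWeight_eq hx.add_I hf hft hα,
          contourIntegral_add_const]
        simp only [hfI, barnesWeight_add_I]
        congr 2 with w
        ring
    _ = (-I) ^ n * contourIntegral γ fun w => (-I) ^ m * c * exp s *
          ((∏ b, (w - x b)) * f w * barnesWeight s y x w) := by
        congr 1
        refine contourIntegral_congr fun w hw => ?_
        have hshift := barnesWeight_piecewise_sub_I (s := s) (y := y) Finset.univ
          fun b _ => h.ne_right hw b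
        rw [Finset.piecewise_univ, Finset.card_univ, Fintype.card_fin] at hshift
        rw [hshift]
        ring
    _ = _ := by
        rw [contourIntegral_const_mul]
        ring

end SeparatesPoles

open Polynomial in
theorem HasExpType.eval_mul_centeredExp {a b : ℝ} {m : ℕ} (p : ℂ[X]) (k : Fin (m + 1)) :
    HasExpType a b (Real.pi * m) fun w => p.eval w * centeredExp (m + 1) k w := by
  intro β hβ
  have h := (polynomial_comp p (HasExpType.id (a := a) (b := b))).mul
    (exp_mul_add (Real.pi * (2 * k - (((m + 1 : ℕ) : ℂ) - 1))) 0)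
  refine (h β ?_).congr_left fun w => by rw [add_zero, centeredExp]
  refine lt_of_le_of_lt ?_ hβ
  have hk : ((k : ℕ) : ℝ) ≤ m := mod_cast Nat.lt_succ_iff.1 k.2
  have hre : ((Real.pi : ℂ) * (2 * k - (((m + 1 : ℕ) : ℂ) - 1))).re = Real.pi * (2 * k - m) := by
    simp
  rw [hre, zero_add, abs_mul, abs_of_pos Real.pi_pos]
  gcongr
  rw [abs_le]
  constructor <;> linarith [(k : ℕ).cast_nonneg (α := ℝ)]

theorem differentiable_centeredExp (n k : ℕ) : Differentiable ℂ (centeredExp n k) := by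
  unfold centeredExp
  fun_prop

section BarnesFunctional

open Polynomial

variable {m : ℕ} {γ γ' : ℝ → ℂ} {s : ℝ} {y : Fin (m + 1) → ℂ} {x : Fin m → ℂ}

theorem SeparatesPoles.integrable_eval_mul_centeredExp_mul (h : SeparatesPoles γ y x) (s : ℝ)
    (p : ℂ[X]) (k : Fin (m + 1)) :
    Integrable fun t => p.eval (γ t) * centeredExp (m + 1) k (γ t) * barnesWeight s y x (γ t) *
      deriv γ t :=
  h.integrable_mul_barnesWeight (f := fun w => p.eval w * centeredExp (m + 1) k w)
    (p.differentiable.mul (differentiable_centeredExp _ _))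
    (fun _ _ => .eval_mul_centeredExp p k) (by push_cast; nlinarith [Real.pi_pos])

/-- The moments of `barnesWeight` against the exponentials `centeredExp`, as a functional on
polynomials. -/
noncomputable def barnesFunctional (h : SeparatesPoles γ y x) (s : ℝ) :
    ℂ[X] →ₗ[ℂ] Fin (m + 1) → ℂ where
  toFun p k := contourIntegral γ fun w => p.eval w * centeredExp (m + 1) k w * barnesWeight s y x w
  map_add' p q := by
    ext k
    rw [Pi.add_apply, ← contourIntegral_add (h.integrable_eval_mul_centeredExp_mul s p k)
      (h.integrable_eval_mul_centeredExp_mul s q k)]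
    simp only [eval_add, add_mul]
  map_smul' c p := by
    ext k
    rw [RingHom.id_apply, Pi.smul_apply, smul_eq_mul, ← contourIntegral_const_mul]
    simp only [eval_smul, smul_eq_mul, mul_assoc]

theorem barnesFunctional_apply (h : SeparatesPoles γ y x) (p : ℂ[X]) (k : Fin (m + 1)) :
    barnesFunctional h s p k =
      contourIntegral γ fun w => p.eval w * centeredExp (m + 1) k w * barnesWeight s y x w :=
  rfl

theorem barnesFunctional_eq (h : SeparatesPoles γ y x) (h' : SeparatesPoles γ' y x) (s : ℝ) :
    barnesFunctional h s = barnesFunctional h' s := by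
  refine LinearMap.ext fun p => funext fun k => ?_
  exact h.contourIntegral_mul_barnesWeight_eq h' (f := fun w => p.eval w * centeredExp (m + 1) k w)
    (p.differentiable.mul (differentiable_centeredExp _ _))
    (fun _ _ => .eval_mul_centeredExp p k) (by push_cast; nlinarith [Real.pi_pos])

theorem barnesFunctional_prod_X_sub_C (h : SeparatesPoles γ y x) (s : ℝ) :
    barnesFunctional h s (∏ b, (X - C (y b))) =
      (-I * exp s) • barnesFunctional h s (∏ b, (X - C (x b))) := by
  ext k
  have hshift := h.contourIntegral_prod_sub_mul (s := s) (differentiable_centeredExp (m + 1) k)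
    (fun a b => by simpa using HasExpType.eval_mul_centeredExp 1 k)
    (by push_cast; nlinarith [Real.pi_pos]) (centeredExp_succ_add_I m k)
  have hpow : (-I) ^ (m + 1 + m) * (-1) ^ m = -I := by
    rw [add_right_comm, pow_succ, ← two_mul, pow_mul, neg_sq, I_sq, mul_right_comm, ← mul_pow]
    simp
  rw [hpow] at hshift
  simpa only [barnesFunctional_apply, Pi.smul_apply, smul_eq_mul, eval_prod, eval_sub, eval_X,
    eval_C] using hshift

theorem barnesFunctional_piecewise_singleton (h : SeparatesPoles γ y x) (s : ℝ) (b : Fin m) :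
    barnesFunctional (h.piecewise_sub_I {b}) s =
      -I • (barnesFunctional h s ∘ₗ LinearMap.mulLeft ℂ (X - C (x b))) := by
  refine LinearMap.ext fun p => funext fun k => ?_
  rw [LinearMap.smul_apply, Pi.smul_apply, LinearMap.comp_apply, LinearMap.mulLeft_apply,
    barnesFunctional_apply, barnesFunctional_apply, smul_eq_mul, ← contourIntegral_const_mul]
  refine contourIntegral_congr fun w hw => ?_
  rw [barnesWeight_piecewise_sub_I _ fun b _ => h.ne_right hw b, Finset.card_singleton,
    Finset.prod_singleton, eval_mul, eval_sub, eval_X, eval_C]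
  ring

end BarnesFunctional

section BarnesDet

open Polynomial

theorem momentDet_smul {R : Type*} [CommRing R] {n : ℕ} (c : R) (L : R[X] →ₗ[R] Fin n → R) :
    momentDet (c • L) = c ^ n * momentDet L := by
  have hmat : (Matrix.of fun j : Fin n => (c • L) (X ^ (j : ℕ))) =
      c • Matrix.of fun j : Fin n => L (X ^ (j : ℕ)) := rfl
  rw [momentDet, momentDet, hmat, Matrix.det_smul, Fintype.card_fin]

variable {m : ℕ} {γ : ℝ → ℂ} {y : Fin (m + 1) → ℂ} {x : Fin m → ℂ}

theorem barnesWeight_eq_exp_mul {n m : ℕ} (s s₀ : ℝ) (y : Fin n → ℂ) (x : Fin m → ℂ) (w : ℂ) :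
    barnesWeight s y x w = exp ((s - s₀) * w / I) * barnesWeight s₀ y x w := by
  have hexp : exp (s * w / I) = exp ((s - s₀) * w / I) * exp (s₀ * w / I) := by
    rw [← exp_add, ← add_div, ← add_mul, sub_add_cancel]
  rw [barnesWeight, barnesWeight, hexp, mul_assoc]

theorem norm_exp_mul_div_I_le {L r : ℝ} {w : ℂ} (hr : |r| ≤ 1) (hw : |w.im| ≤ L) :
    ‖exp (r * w / I)‖ ≤ Real.exp L := by
  have hre : (r * w / I).re = r * w.im := by simp [div_I]
  rw [norm_exp, hre]
  gcongr
  calc r * w.im ≤ |r| * |w.im| := (le_abs_self _).trans (abs_mul _ _).le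
    _ ≤ 1 * L := by gcongr
    _ = L := one_mul L

theorem hasDerivAt_barnesWeight {n m : ℕ} (s : ℝ) (y : Fin n → ℂ) (x : Fin m → ℂ) (w : ℂ) :
    HasDerivAt (fun s => barnesWeight s y x w) (-I * (w * barnesWeight s y x w)) s := by
  have hlin : HasDerivAt (fun s : ℝ => s * w / I) (1 * w / I) s :=
    (ofRealCLM.hasDerivAt (x := s)).mul_const w |>.div_const I
  refine (hlin.cexp.mul_const _).congr_deriv ?_
  rw [barnesWeight, one_mul, div_I w]
  ring

theorem hasDerivAt_barnesFunctional (h : SeparatesPoles γ y x) (s : ℝ) (p : ℂ[X]) :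
    HasDerivAt (fun s => barnesFunctional h s p) (-I • barnesFunctional h s (X * p)) s := by
  refine hasDerivAt_pi.2 fun k => ?_
  obtain ⟨L, hL⟩ := h.isStripContour.im_bounded
  let F (r t : ℝ) : ℂ :=
    p.eval (γ t) * centeredExp (m + 1) k (γ t) * barnesWeight r y x (γ t) * deriv γ t
  let G (t : ℝ) : ℂ :=
    (X * p).eval (γ t) * centeredExp (m + 1) k (γ t) * barnesWeight s y x (γ t) * deriv γ t
  have hF (r : ℝ) : Integrable (F r) := h.integrable_eval_mul_centeredExp_mul r p k
  have hG : Integrable G := h.integrable_eval_mul_centeredExp_mul s (X * p) k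
  have hFG (r t : ℝ) : γ t * F r t = exp ((r - s : ℝ) * γ t / I) * G t := by
    simp only [F, G, eval_mul, eval_X, barnesWeight_eq_exp_mul r s, ofReal_sub]
    ring
  have hderiv := (hasDerivAt_integral_of_dominated_loc_of_deriv_le (F := F)
    (F' := fun r t => -I * (γ t * F r t)) (bound := fun t => Real.exp L * ‖G t‖)
    (Metric.ball_mem_nhds s one_pos) (.of_forall fun r => (hF r).1) (hF s) ?_ ?_
    (hG.norm.const_mul _) ?_).2
  · refine hderiv.congr_deriv ?_
    simp only [hFG, sub_self, ofReal_zero, zero_mul, zero_div, exp_zero, one_mul]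
    rw [integral_const_mul]
    rfl
  · simp only [hFG, sub_self, ofReal_zero, zero_mul, zero_div, exp_zero, one_mul]
    exact hG.1.const_mul _
  · refine .of_forall fun t r hr => ?_
    rw [hFG, norm_mul, norm_neg, norm_I, one_mul, norm_mul]
    gcongr
    exact norm_exp_mul_div_I_le (Metric.mem_ball.1 hr).le (hL t)
  · refine .of_forall fun t r _ => ?_
    refine (((hasDerivAt_barnesWeight r y x (γ t)).const_mul _).mul_const _).congr_deriv ?_
    ring

theorem momentDet_barnesFunctional_piecewise_singleton (h : SeparatesPoles γ y x) (s : ℝ)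
    (b : Fin m) : momentDet (barnesFunctional (h.piecewise_sub_I {b}) s) =
      (∏ a, (y a - x b) / I) * momentDet (barnesFunctional h s) := by
  have hQ : (∏ c ∈ Finset.univ.erase b, (X - C (x c))).degree < (m : WithBot ℕ) := by
    have hcard : (Finset.univ.erase b).card < m :=
      (Finset.card_erase_lt_of_mem (Finset.mem_univ b)).trans_eq (by simp)
    rw [degree_prod]
    simpa using hcard
  rw [barnesFunctional_piecewise_singleton h, momentDet_smul,
    momentDet_comp_mulLeft_X_sub_C (barnesFunctional h s) _ (-I * exp s)
    (monic_prod_X_sub_C y Finset.univ) (by simp) hQ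
    (by rw [barnesFunctional_prod_X_sub_C,
      Finset.mul_prod_erase _ (fun c => X - C (x c)) (Finset.mem_univ b)]),
    eval_prod, ← mul_assoc, ← mul_assoc, ← mul_pow]
  congr 1
  calc (-I * -1) ^ (m + 1) * ∏ a, (X - C (y a)).eval (x b)
      = ∏ a, (-I * -1) * (X - C (y a)).eval (x b) := by
        rw [Finset.prod_mul_distrib, Finset.prod_const, Finset.card_univ, Fintype.card_fin]
    _ = ∏ a, (y a - x b) / I := by
        simp only [eval_sub, eval_X, eval_C, div_I]
        exact Finset.prod_congr rfl fun a _ => by ring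

theorem hasDerivAt_momentDet_barnesFunctional (h : SeparatesPoles γ y x) (s : ℝ) :
    HasDerivAt (fun s => momentDet (barnesFunctional h s))
      (((∑ a, y a) / I - exp s) * momentDet (barnesFunctional h s)) s := by
  set Y : ℂ[X] := ∏ a, (X - C (y a)) with hYdef
  set Q : ℂ[X] := ∏ b, (X - C (x b)) with hQdef
  have hY : Y.Monic := monic_prod_X_sub_C y Finset.univ
  have hYdeg : Y.natDegree = m + 1 := by simp [hYdef]
  have hQ : Q.natDegree = m := by simp [hQdef]
  have hYcoeff : Y.coeff m = -∑ a, y a := by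
    simpa [hYdef] using prod_X_sub_C_coeff_card_pred Finset.univ y (by simp)
  have hQcoeff : Q.coeff m = 1 := by
    rw [← hQ]
    exact monic_prod_X_sub_C x Finset.univ
  have hrem : (X ^ (m + 1) - Y).natDegree ≤ m := by
    rw [natDegree_sub]
    exact Nat.lt_succ_iff.1 ((IsMonicOfDegree.mk hYdeg hY).natDegree_sub_X_pow m.succ_ne_zero)
  refine (hasDerivAt_momentDet (q := (-I * exp s) • Q + (X ^ (m + 1) - Y)) (d := -I)
    (hasDerivAt_barnesFunctional h s) ?_ ?_).congr_deriv ?_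
  · exact natDegree_add_le_of_degree_le ((natDegree_smul_le _ _).trans hQ.le) hrem
  · rw [map_add, map_smul, map_sub, ← barnesFunctional_prod_X_sub_C, add_sub_cancel]
  · rw [coeff_add, coeff_smul, coeff_sub, coeff_X_pow, hYcoeff, hQcoeff, if_neg (by simp), div_I]
    linear_combination (exp s * momentDet (barnesFunctional h s)) * I_mul_I

theorem momentDet_barnesFunctional_mul_exp_eq (h : SeparatesPoles γ y x) (s s' : ℝ) :
    momentDet (barnesFunctional h s) * exp (exp s - s * (∑ a, y a) / I) =
      momentDet (barnesFunctional h s') * exp (exp s' - s' * (∑ a, y a) / I) := by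
  have hderiv (s : ℝ) : HasDerivAt (fun s : ℝ => momentDet (barnesFunctional h s) *
      exp (exp s - s * (∑ a, y a) / I)) 0 s := by
    have hid : HasDerivAt (fun s : ℝ => (s : ℂ)) 1 s := ofRealCLM.hasDerivAt
    refine ((hasDerivAt_momentDet_barnesFunctional h s).mul
      (hid.cexp.sub ((hid.mul_const _).div_const I)).cexp).congr_deriv ?_
    ring
  exact is_const_of_deriv_eq_zero (fun s => (hderiv s).differentiableAt)
    (fun s => (hderiv s).deriv) s s'

end BarnesDet

section MellinInversion

variable {a b s : ℝ} {y : ℂ}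

theorem horizontalLine_mem_strip {α : ℝ} (hα : α ∈ Ioo a b) (t : ℝ) :
    (horizontalLine α t).im ∈ Ioo a b := hα

theorem mellin_exp_neg {z : ℂ} (hz : 0 < z.re) :
    mellin (fun x => (Real.exp (-x) : ℂ)) z = Gamma z := by
  rw [Gamma_eq_integral hz, GammaIntegral_eq_mellin]

theorem verticalIntegrable_Gamma {σ : ℝ} (hσ : 0 < σ) : VerticalIntegrable Gamma σ := by
  have hu (w : ℂ) : σ + w * I = I * (w - σ * I) := by linear_combination σ * I_mul_I
  have hcont : ContinuousOn (fun w => Gamma (σ + w * I)) (range (horizontalLine 0)) := by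
    rintro w ⟨t, rfl⟩
    refine ContinuousAt.continuousWithinAt (ContinuousAt.comp (g := Gamma) ?_ (by fun_prop))
    exact (differentiableAt_Gamma_of_re_pos (by simpa [horizontalLine])).continuousAt
  have hint := (isStripContour_horizontalLine 0).integrable_of_isBigO
    (horizontalLine_mem_strip (a := -1) (b := 1) (by norm_num)) hcont
    ((HasExpType.Gamma_comp I_ne_zero I_re hu).isBigO_inv_sq (by simp [Real.pi_pos]))
  refine hint.congr (.of_forall fun t => ?_)
  simp only [(hasDerivAt_horizontalLine 0 t).deriv, mul_one]
  rfl

theorem integral_Gamma_mul_exp {σ : ℝ} (hσ : 0 < σ) (s : ℝ) :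
    ∫ v : ℝ, Gamma (σ + v * I) * exp (-(s * (σ + v * I))) = 2 * Real.pi * exp (-exp s) := by
  have hmellin (v : ℝ) :
      mellin (fun x => (Real.exp (-x) : ℂ)) (σ + v * I) = Gamma (σ + v * I) :=
    mellin_exp_neg (by simpa using hσ)
  have hconv : MellinConvergent (fun x => (Real.exp (-x) : ℂ)) σ := by
    simpa [MellinConvergent, mul_comm] using
      GammaIntegral_convergent (s := (σ : ℂ)) (by simpa using hσ)
  have hinv := mellinInv_mellin_eq σ _ (Real.exp_pos s) hconv
    ((verticalIntegrable_Gamma hσ).congr (.of_forall fun v => (hmellin v).symm)) (by fun_prop)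
  have hpow (z : ℂ) : (Real.exp s : ℂ) ^ (-z) = exp (-(s * z)) := by
    rw [cpow_def_of_ne_zero (ofReal_ne_zero.2 (Real.exp_pos s).ne'),
      ← ofReal_log (Real.exp_pos s).le, Real.log_exp, mul_neg]
  simp only [mellinInv, hmellin, hpow, smul_eq_mul, real_smul] at hinv
  have hpi : (2 * Real.pi : ℂ) ≠ 0 := mul_ne_zero two_ne_zero (ofReal_ne_zero.2 Real.pi_ne_zero)
  simp only [mul_comm (Gamma _)]
  push_cast at hinv
  rw [← hinv, ← mul_assoc, mul_one_div_cancel hpi, one_mul]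

theorem contourIntegral_Gamma_mul_exp {α : ℝ} (hα : α < y.im) (s : ℝ) :
    contourIntegral (horizontalLine α) (fun w => Gamma ((y - w) / I) * exp (s * (w - y) / I)) =
      2 * Real.pi * exp (-exp s) := by
  rw [contourIntegral_horizontalLine, ← integral_Gamma_mul_exp (sub_pos.2 hα) s,
    ← integral_sub_right_eq_self (fun v : ℝ => Gamma ((y.im - α : ℝ) + v * I) * _) y.re]
  congr 1 with t
  have hz : (y - horizontalLine α t) / I = ((y.im - α : ℝ) : ℂ) + ((t - y.re : ℝ) : ℂ) * I := by
    apply Complex.ext <;> simp [div_I, horizontalLine]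
  rw [← hz]
  congr 2
  ring

theorem tendsto_exp_neg_exp_atBot : Tendsto (fun s : ℝ => exp (-exp s)) atBot (𝓝 1) := by
  have hexp := Real.tendsto_exp_atBot.ofReal
  simpa using hexp.neg.cexp

section Asymptotics

variable {α : ℝ} {g : ℂ → ℂ}

theorem re_sub_div_I (y w : ℂ) : ((y - w) / I).re = y.im - w.im := by simp [div_I]

theorem sub_mul_Gamma_div_I {w : ℂ} (hw : w ≠ y) :
    (w - y) * Gamma ((y - w) / I) = -I * Gamma ((y - w) / I + 1) := by
  rw [Gamma_add_one _ (div_ne_zero (sub_ne_zero.2 hw.symm) I_ne_zero), div_I]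
  linear_combination (w - y) * Gamma (-((y - w) * I)) * I_mul_I

theorem norm_exp_mul_sub_div_I (s : ℝ) (w y : ℂ) :
    ‖exp (s * (w - y) / I)‖ = Real.exp (s * (w.im - y.im)) := by
  simp [norm_exp, div_I]

theorem differentiableOn_mul_Gamma_div_I_add {c : ℝ} (hb : b ≤ y.im + c)
    (hg : DifferentiableOn ℂ g (im ⁻¹' Ioo a b)) :
    DifferentiableOn ℂ (fun w => g w * Gamma ((y - w) / I + c)) (im ⁻¹' Ioo a b) := by
  refine hg.mul fun w hw => DifferentiableAt.differentiableWithinAt ?_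
  refine DifferentiableAt.comp (g := Gamma) w (differentiableAt_Gamma_of_re_pos ?_) (by fun_prop)
  rw [add_re, re_sub_div_I, ofReal_re]
  linarith [hw.2]

theorem HasExpType.mul_Gamma_div_I_add (hg : HasExpType a b 0 g) (y c : ℂ) :
    HasExpType a b (-(Real.pi / 2)) fun w => g w * Gamma ((y - w) / I + c) := by
  have hGamma := Gamma_comp (a := a) (b := b) (c := I) (p := y + I * c)
    (u := fun w => (y - w) / I + c) I_ne_zero I_re fun w => by
      rw [div_I]; linear_combination c * I_mul_I
  simpa using hg.mul hGamma

theorem HasExpType.exp_mul_sub_div_I (s : ℝ) (y : ℂ) :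
    HasExpType a b 0 fun w => exp (s * (w - y) / I) := by
  have hexp := exp_mul_add (a := a) (b := b) (-(s * I)) (s * y * I)
  rw [neg_re, re_ofReal_mul, I_re, mul_zero, neg_zero, abs_zero] at hexp
  refine hexp.congr (.of_forall fun w => ?_)
  simp only [div_I]
  ring_nf

theorem isBigO_mul_Gamma_div_I_mul_exp (hgt : HasExpType a b 0 g) (y c : ℂ) (s : ℝ) :
    (fun w => g w * Gamma ((y - w) / I + c) * exp (s * (w - y) / I)) =O[stripEnds a b]
      fun w => w⁻¹ ^ 2 :=
  ((hgt.mul_Gamma_div_I_add y c).mul (.exp_mul_sub_div_I s y)).isBigO_inv_sq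
    (by linarith [Real.pi_pos])

theorem integrable_mul_Gamma_div_I_mul_exp {c : ℝ} (hb : b ≤ y.im + c)
    (hg : DifferentiableOn ℂ g (im ⁻¹' Ioo a b)) (hgt : HasExpType a b 0 g) (hα : α ∈ Ioo a b)
    (s : ℝ) : Integrable fun t => g (horizontalLine α t) *
      Gamma ((y - horizontalLine α t) / I + c) * exp (s * (horizontalLine α t - y) / I) *
        deriv (horizontalLine α) t :=
  (isStripContour_horizontalLine α).integrable_of_isBigO (horizontalLine_mem_strip hα)
    (((differentiableOn_mul_Gamma_div_I_add hb hg).continuousOn.mono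
      (range_subset_iff.2 (horizontalLine_mem_strip hα))).mul (by fun_prop))
    (isBigO_mul_Gamma_div_I_mul_exp hgt y c s)

/-- The integrand is holomorphic up to height `y.im + 1`, so the line can be moved above `y`, where
the exponential is small. -/
theorem tendsto_contourIntegral_mul_Gamma_add_one
    (hg : DifferentiableOn ℂ g (im ⁻¹' Ioo a (y.im + 1)))
    (hgt : HasExpType a (y.im + 1) 0 g) (hα : α ∈ Ioo a y.im) :
    Tendsto (fun s : ℝ => contourIntegral (horizontalLine α) fun w =>
      g w * Gamma ((y - w) / I + 1) * exp (s * (w - y) / I)) atBot (𝓝 0) := by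
  have hβ : y.im + 1 / 2 ∈ Ioo a (y.im + 1) := ⟨by linarith [hα.1, hα.2], by linarith⟩
  have hdiff : DifferentiableOn ℂ (fun w => g w * Gamma ((y - w) / I + 1))
      (im ⁻¹' Ioo a (y.im + 1)) := by
    simpa using differentiableOn_mul_Gamma_div_I_add (c := 1) le_rfl hg
  have hshift (s : ℝ) := (isStripContour_horizontalLine α).contourIntegral_eq_of_differentiableOn
    (isStripContour_horizontalLine (y.im + 1 / 2))
    (horizontalLine_mem_strip ⟨hα.1, hα.2.trans (lt_add_one _)⟩) (horizontalLine_mem_strip hβ)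
    (f := fun w => g w * Gamma ((y - w) / I + 1) * exp (s * (w - y) / I))
    (hdiff.mul (by fun_prop))
    (isBigO_mul_Gamma_div_I_mul_exp hgt y 1 s)
  have hexp : Tendsto (fun s : ℝ => Real.exp (s * (1 / 2)) *
      ∫ t, ‖g (horizontalLine (y.im + 1 / 2) t) *
        Gamma ((y - horizontalLine (y.im + 1 / 2) t) / I + 1)‖) atBot (𝓝 0) := by
    simpa using (Real.tendsto_exp_atBot.comp
      (tendsto_id.atBot_mul_const (by norm_num : (0 : ℝ) < 1 / 2))).mul_const _
  refine squeeze_zero_norm (fun s => ?_) hexp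
  rw [hshift, contourIntegral_horizontalLine, ← integral_const_mul]
  refine (norm_integral_le_integral_norm _).trans_eq (integral_congr_ae (.of_forall fun t => ?_))
  simp only [norm_mul, norm_exp_mul_sub_div_I, horizontalLine, add_sub_cancel_left]
  ring

theorem tendsto_contourIntegral_mul_Gamma (hg : DifferentiableOn ℂ g (im ⁻¹' Ioo a (y.im + 1)))
    (hgt : HasExpType a (y.im + 1) 0 g) (hα : α ∈ Ioo a y.im) :
    Tendsto (fun s : ℝ => contourIntegral (horizontalLine α) fun w =>
      g w * Gamma ((y - w) / I) * exp (s * (w - y) / I)) atBot (𝓝 (2 * Real.pi * g y)) := by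
  have hy : im ⁻¹' Ioo a (y.im + 1) ∈ 𝓝 y :=
    (isOpen_strip _ _).mem_nhds ⟨hα.1.trans hα.2, lt_add_one _⟩
  have hd := (Complex.differentiableOn_dslope hy).2 hg
  have hdecomp (s : ℝ) : contourIntegral (horizontalLine α)
      (fun w => g w * Gamma ((y - w) / I) * exp (s * (w - y) / I)) =
      g y * (2 * Real.pi * exp (-exp s)) + -I * contourIntegral (horizontalLine α) (fun w =>
        dslope g y w * Gamma ((y - w) / I + 1) * exp (s * (w - y) / I)) := by
    rw [← contourIntegral_Gamma_mul_exp hα.2 s, ← contourIntegral_const_mul,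
      ← contourIntegral_const_mul, ← contourIntegral_add]
    · refine contourIntegral_congr ?_
      rintro _ ⟨t, rfl⟩
      have hne : horizontalLine α t ≠ y := fun h => hα.2.ne (congrArg im h)
      have hslope := sub_smul_dslope g y (horizontalLine α t)
      rw [smul_eq_mul] at hslope
      linear_combination
        (-Gamma ((y - horizontalLine α t) / I) * exp (s * (horizontalLine α t - y) / I)) * hslope +
        dslope g y (horizontalLine α t) * exp (s * (horizontalLine α t - y) / I) *
          sub_mul_Gamma_div_I hne
    · simpa [mul_assoc] using integrable_mul_Gamma_div_I_mul_exp (c := 0) (y := y)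
        (by rw [add_zero]) (differentiableOn_const (g y)) (.const (g y)) hα s
    · simpa [mul_assoc] using (integrable_mul_Gamma_div_I_mul_exp (c := 1) le_rfl hd
        (hgt.dslope y) ⟨hα.1, hα.2.trans (lt_add_one _)⟩ s).const_mul (-I)
  have hlim := ((tendsto_exp_neg_exp_atBot.const_mul (2 * Real.pi : ℂ)).const_mul (g y)).add
    ((tendsto_contourIntegral_mul_Gamma_add_one hd (hgt.dslope y) hα).const_mul (-I))
  refine (hlim.congr fun s => (hdecomp s).symm).mono_right (le_of_eq ?_)
  ring_nf

end Asymptotics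

end MellinInversion

section GenericEvaluation

open Polynomial

theorem exists_prod_sinh_eq_sum {ι : Type*} {m : ℕ} {S : Finset ι} (hS : S.card = m) (y : ι → ℂ) :
    ∃ c : Fin (m + 1) → ℂ, ∀ w, ∏ b ∈ S, sinh (Real.pi * (w - y b)) / Real.pi =
      ∑ k, c k * centeredExp (m + 1) k w := by
  set q : ι → ℂ[X] := fun b => C (exp (-(Real.pi * y b)) / (2 * Real.pi)) * X +
    C (-exp (Real.pi * y b) / (2 * Real.pi)) with hq
  have hdeg : (∏ b ∈ S, q b).natDegree < m + 1 := by
    refine Nat.lt_succ_of_le ((natDegree_prod_le S q).trans ?_)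
    refine (Finset.sum_le_card_nsmul S _ 1 fun b _ => natDegree_linear_le).trans ?_
    simp [hS]
  refine ⟨fun k => (∏ b ∈ S, q b).coeff k, fun w => ?_⟩
  have hsinh (b) : sinh (Real.pi * (w - y b)) / Real.pi =
      exp (-(Real.pi * w)) * (q b).eval (exp (2 * (Real.pi * w))) := by
    have htwo := two_sinh (Real.pi * (w - y b))
    have hpos : exp (Real.pi * (w - y b)) = exp (-(Real.pi * w)) *
        (exp (-(Real.pi * y b)) * exp (2 * (Real.pi * w))) := by
      simp only [← exp_add]
      ring_nf
    have hneg : exp (-(Real.pi * (w - y b))) = exp (-(Real.pi * w)) * exp (Real.pi * y b) := by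
      rw [← exp_add]
      ring_nf
    rw [hpos, hneg] at htwo
    simp only [hq, eval_add, eval_mul, eval_C, eval_X]
    rw [eq_div_of_mul_eq two_ne_zero ((mul_comm _ _).trans htwo)]
    ring
  have hexp (k : ℕ) : exp (-(Real.pi * w)) ^ m * exp (2 * (Real.pi * w)) ^ k =
      centeredExp (m + 1) k w := by
    rw [centeredExp, ← exp_nat_mul, ← exp_nat_mul, ← exp_add]
    push_cast
    ring_nf
  simp only [hsinh, Finset.prod_mul_distrib, Finset.prod_const, hS]
  rw [← eval_prod, eval_eq_sum_range' hdeg, Finset.mul_sum, Finset.sum_range]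
  exact Finset.sum_congr rfl fun k _ => by rw [← hexp]; ring

theorem inv_Gamma_mul_inv_I_mul_Gamma_one_sub (y w : ℂ) :
    (Gamma ((y - w) / I))⁻¹ * (I * Gamma (1 - (y - w) / I))⁻¹ =
      sinh (Real.pi * (w - y)) / Real.pi := by
  have hsin : sin (Real.pi * ((y - w) / I)) = sinh (Real.pi * (w - y)) * I := by
    rw [← sin_mul_I, div_I]
    ring_nf
  rw [mul_inv, mul_left_comm, ← mul_inv, Gamma_mul_Gamma_one_sub, inv_div, hsin, mul_div_assoc',
    mul_comm _ I, inv_mul_cancel_left₀ I_ne_zero]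

theorem Gamma_mul_sinh {y w : ℂ} (hw : w.im < y.im) :
    Gamma ((y - w) / I) * (sinh (Real.pi * (w - y)) / Real.pi) =
      (I * Gamma (1 - (y - w) / I))⁻¹ := by
  rw [← inv_Gamma_mul_inv_I_mul_Gamma_one_sub, mul_inv_cancel_left₀]
  exact Gamma_ne_zero_of_re_pos (by rw [re_sub_div_I]; linarith)

theorem prod_prod_erase_eq_prod_offDiag {ι M : Type*} [Fintype ι] [DecidableEq ι] [CommMonoid M]
    (F : ι → ι → M) : ∏ k, ∏ b ∈ Finset.univ.erase k, F k b =
      ∏ p ∈ (Finset.univ : Finset ι).offDiag, F p.2 p.1 := by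
  rw [Finset.prod_sigma']
  exact Finset.prod_nbij' (fun p => (p.2, p.1)) (fun p => ⟨p.2, p.1⟩) (by simp) (by simp)
    (by simp) (by simp) (by simp)

variable {m : ℕ} {a α : ℝ} {y : Fin (m + 1) → ℂ} {x : Fin m → ℂ}

theorem separatesPoles_horizontalLine {n m : ℕ} {y : Fin n → ℂ} {x : Fin m → ℂ}
    (hy : ∀ b, α < (y b).im) (hx : ∀ b, (x b).im < α) :
    SeparatesPoles (horizontalLine α) y x where
  isStripContour := isStripContour_horizontalLine α
  above b k := .of_forall_lt fun _ => (hy b).trans_le (by simp)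
  below b k := .of_forall_lt fun t => lt_of_le_of_lt (by simp) (hx b)

/-- What remains of the product of Gamma functions in `barnesWeight s y x w` when all but its
`k`-th factor `Γ ((y b - w) / I)` are multiplied by `sinh (π (w - y b)) / π`. -/
noncomputable def reflectedWeight (y : Fin (m + 1) → ℂ) (x : Fin m → ℂ) (k : Fin (m + 1))
    (w : ℂ) : ℂ :=
  (∏ b, Gamma ((w - x b) / I)) * ∏ b ∈ Finset.univ.erase k, (I * Gamma (1 - (y b - w) / I))⁻¹

theorem differentiableOn_reflectedWeight (hx : ∀ b, (x b).im < a) (k : Fin (m + 1)) (b : ℝ) :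
    DifferentiableOn ℂ (reflectedWeight y x k) (im ⁻¹' Ioo a b) := by
  refine .mul (.fun_finsetProd fun i _ w hw => ?_) (.fun_finsetProd fun i _ => ?_)
  · refine (DifferentiableAt.comp (g := Gamma) w (differentiableAt_Gamma_of_re_pos ?_)
      (by fun_prop)).differentiableWithinAt
    rw [re_sub_div_I]
    linarith [hx i, hw.1]
  · have hinv : Differentiable ℂ fun w => (Gamma (1 - (y i - w) / I))⁻¹ :=
      differentiable_one_div_Gamma.comp (by fun_prop : Differentiable ℂ fun w => 1 - (y i - w) / I)
    simp only [mul_inv]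
    exact (hinv.const_mul _).differentiableOn

theorem HasExpType.reflectedWeight (b : ℝ) (y : Fin (m + 1) → ℂ) (x : Fin m → ℂ)
    (k : Fin (m + 1)) : HasExpType a b 0 (reflectedWeight y x k) := by
  have hGamma := prod (a := a) (b := b) (s := Finset.univ) (F := fun b w => Gamma ((w - x b) / I))
    fun i _ => Gamma_comp (c := -I) (p := x i) (by simp) (by simp) fun w => by rw [div_I]; ring
  have hinv := prod (a := a) (b := b) (s := Finset.univ.erase k)
    (F := fun b w => (I * Gamma (1 - (y b - w) / I))⁻¹) fun i _ => by
      simpa only [mul_inv] using (const I⁻¹).mul (inv_Gamma_comp (c := -I) (p := y i - I)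
        (u := fun w => 1 - (y i - w) / I) (by simp) (by simp) fun w => by
          rw [div_I]; linear_combination I_mul_I)
  convert! hGamma.mul hinv using 1
  simp

theorem sum_mul_barnesWeight_eq {k : Fin (m + 1)} {c : Fin (m + 1) → ℂ}
    (hc : ∀ w, ∏ b ∈ Finset.univ.erase k, sinh (Real.pi * (w - y b)) / Real.pi =
      ∑ l, c l * centeredExp (m + 1) l w) (s : ℝ) {w : ℂ} (hw : ∀ b, w.im < (y b).im) :
    (∑ l, c l * centeredExp (m + 1) l w) * barnesWeight s y x w =
      exp (s * w / I) * Gamma ((y k - w) / I) * reflectedWeight y x k w := by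
  have hreflect : ∏ b ∈ Finset.univ.erase k, (I * Gamma (1 - (y b - w) / I))⁻¹ =
      (∏ b ∈ Finset.univ.erase k, Gamma ((y b - w) / I)) * ∑ l, c l * centeredExp (m + 1) l w := by
    rw [← hc, ← Finset.prod_mul_distrib]
    exact Finset.prod_congr rfl fun b _ => (Gamma_mul_sinh (hw b)).symm
  rw [reflectedWeight, hreflect, barnesWeight, ← Finset.mul_prod_erase _ _ (Finset.mem_univ k)]
  ring

theorem tendsto_sum_mul_barnesFunctional (hy : ∀ b, α < (y b).im) (hx : ∀ b, (x b).im < α)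
    (p : ℂ[X]) {k : Fin (m + 1)} {c : Fin (m + 1) → ℂ}
    (hc : ∀ w, ∏ b ∈ Finset.univ.erase k, sinh (Real.pi * (w - y b)) / Real.pi =
      ∑ l, c l * centeredExp (m + 1) l w) :
    Tendsto (fun s : ℝ => exp (-(s * y k / I)) *
      ∑ l, c l * barnesFunctional (separatesPoles_horizontalLine hy hx) s p l) atBot
      (𝓝 (2 * Real.pi * (p.eval (y k) * reflectedWeight y x k (y k)))) := by
  set h := separatesPoles_horizontalLine hy hx
  obtain ⟨a, hxa, ha⟩ : ∃ a, (∀ b, (x b).im < a) ∧ a < α :=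
    ((eventually_all.2 fun b => nhdsWithin_le_nhds (lt_mem_nhds (hx b))).and
      (self_mem_nhdsWithin (s := Iio α))).exists
  have hlim := tendsto_contourIntegral_mul_Gamma
    (p.differentiable.differentiableOn.mul (differentiableOn_reflectedWeight (y := y) hxa k _))
    (add_zero (0 : ℝ) ▸ (HasExpType.polynomial_comp p .id).mul (.reflectedWeight _ y x k))
    ⟨ha, hy k⟩
  refine hlim.congr fun s => ?_
  have hint (l : Fin (m + 1)) := (h.integrable_eval_mul_centeredExp_mul s p l).const_mul (c l)
  simp only [← mul_assoc] at hint
  simp only [barnesFunctional_apply, ← contourIntegral_const_mul]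
  rw [← contourIntegral_sum _ fun l _ => by simpa only [← mul_assoc] using hint l,
    ← contourIntegral_const_mul]
  refine contourIntegral_congr ?_
  rintro _ ⟨t, rfl⟩
  have hsum := sum_mul_barnesWeight_eq hc (x := x) s (w := horizontalLine α t) hy
  have hexp : exp (s * (horizontalLine α t - y k) / I) =
      exp (-(s * y k / I)) * exp (s * horizontalLine α t / I) := by
    rw [← exp_add]
    ring_nf
  calc p.eval (horizontalLine α t) * reflectedWeight y x k (horizontalLine α t) *
        Gamma ((y k - horizontalLine α t) / I) * exp (s * (horizontalLine α t - y k) / I)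
      = exp (-(s * y k / I)) * (p.eval (horizontalLine α t) *
          ((∑ l, c l * centeredExp (m + 1) l (horizontalLine α t)) *
            barnesWeight s y x (horizontalLine α t))) := by
        rw [hsum, hexp]
        ring
    _ = _ := by
        simp only [Finset.sum_mul, Finset.mul_sum]
        exact Finset.sum_congr rfl fun l _ => by ring

theorem exists_momentDet_barnesFunctional_eq {γ : ℝ → ℂ} (h : SeparatesPoles γ y x) :
    ∃ K, ∀ s : ℝ, momentDet (barnesFunctional h s) =
      K * (exp (s * (∑ a, y a) / I) * exp (-exp s)) := by
  refine ⟨momentDet (barnesFunctional h 0) * exp (exp (0 : ℝ) - (0 : ℝ) * (∑ a, y a) / I),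
    fun s => ?_⟩
  rw [momentDet_barnesFunctional_mul_exp_eq h 0 s, mul_assoc, ← exp_add, ← exp_add]
  simp

theorem prod_reflectedWeight_mul_vandermonde_mul_sinhVandermonde (y : Fin (m + 1) → ℂ)
    (x : Fin m → ℂ) :
    (∏ k, reflectedWeight y x k (y k)) * ((Matrix.vandermonde y).det * sinhVandermonde y) =
      (∏ k, ∏ b ∈ Finset.univ.erase k, sinh (Real.pi * (y k - y b)) / Real.pi) *
        ∏ a, ∏ b, Gamma ((y a - x b) / I) := by
  simp only [reflectedWeight, Finset.prod_mul_distrib, ← inv_Gamma_mul_inv_I_mul_Gamma_one_sub]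
  rw [← inv_prod_offDiag_Gamma, ← Finset.prod_inv_distrib,
    prod_prod_erase_eq_prod_offDiag fun k b => (Gamma ((y b - y k) / I))⁻¹]
  ring

theorem det_mul_sinhVandermonde {C : Matrix (Fin (m + 1)) (Fin (m + 1)) ℂ}
    (hC : ∀ k w, ∏ b ∈ Finset.univ.erase k, sinh (Real.pi * (w - y b)) / Real.pi =
      ∑ l, C k l * centeredExp (m + 1) l w) :
    C.det * ((2 * Real.pi : ℂ) ^ (m + 1).choose 2 * sinhVandermonde y) =
      ∏ k, ∏ b ∈ Finset.univ.erase k, sinh (Real.pi * (y k - y b)) / Real.pi := by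
  rw [sinhVandermonde_eq_det, ← Matrix.det_mul, ← Matrix.det_diagonal]
  congr 1
  ext k a
  rw [Matrix.mul_apply]
  simp only [Matrix.of_apply]
  rw [← hC k (y a), Matrix.diagonal_apply]
  split_ifs with h
  · rw [h]
  · exact Finset.prod_eq_zero (Finset.mem_erase.2 ⟨Ne.symm h, Finset.mem_univ a⟩) (by simp)

theorem tendsto_det_mul_momentDet_barnesFunctional (hy : ∀ b, α < (y b).im)
    (hx : ∀ b, (x b).im < α) {C : Matrix (Fin (m + 1)) (Fin (m + 1)) ℂ}
    (hC : ∀ k w, ∏ b ∈ Finset.univ.erase k, sinh (Real.pi * (w - y b)) / Real.pi =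
      ∑ l, C k l * centeredExp (m + 1) l w) :
    Tendsto (fun s : ℝ => exp (-(s * (∑ a, y a) / I)) *
        (C.det * momentDet (barnesFunctional (separatesPoles_horizontalLine hy hx) s))) atBot
      (𝓝 ((2 * Real.pi) ^ (m + 1) *
        ((∏ k, reflectedWeight y x k (y k)) * (Matrix.vandermonde y).det))) := by
  set h := separatesPoles_horizontalLine hy hx
  have hlim := (continuous_id.matrix_det.tendsto _).comp <| tendsto_pi_nhds.2 fun k =>
    tendsto_pi_nhds.2 fun j : Fin (m + 1) =>
      tendsto_sum_mul_barnesFunctional hy hx (X ^ (j : ℕ)) (hC k)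
  have hvalue : (Matrix.of fun k j : Fin (m + 1) =>
      2 * Real.pi * ((X ^ (j : ℕ)).eval (y k) * reflectedWeight y x k (y k))).det =
      (2 * Real.pi) ^ (m + 1) *
        ((∏ k, reflectedWeight y x k (y k)) * (Matrix.vandermonde y).det) := by
    have hcol := Matrix.det_mul_column (fun k => 2 * Real.pi * reflectedWeight y x k (y k))
      (Matrix.vandermonde y)
    rw [Finset.prod_mul_distrib, Finset.prod_const, Finset.card_univ, Fintype.card_fin,
      mul_assoc] at hcol
    rw [← hcol]
    congr 1
    ext k j
    simp only [Matrix.of_apply, Matrix.vandermonde_apply, eval_pow, eval_X]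
    ring
  rw [← hvalue]
  refine hlim.congr fun s => ?_
  have hmatrix : (Matrix.of fun k j : Fin (m + 1) => exp (-(s * y k / I)) *
      ∑ l, C k l * barnesFunctional h s (X ^ (j : ℕ)) l) =
      Matrix.of fun k j => exp (-(s * y k / I)) *
        (C * (Matrix.of fun j : Fin (m + 1) =>
          barnesFunctional h s (X ^ (j : ℕ))).transpose) k j := by
    ext k j
    simp only [Matrix.of_apply, Matrix.mul_apply, Matrix.transpose_apply]
  refine (congrArg Matrix.det hmatrix).trans ?_
  rw [Matrix.det_mul_column, ← exp_sum, momentDet, Matrix.det_mul, Matrix.det_transpose,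
    Finset.sum_neg_distrib, ← Finset.sum_div, ← Finset.mul_sum]

theorem momentDet_barnesFunctional_horizontalLine_of_sinh_ne_zero (hy : ∀ b, α < (y b).im)
    (hx : ∀ b, (x b).im < α) (hsinh : ∀ k, ∀ b ≠ k, sinh (Real.pi * (y k - y b)) ≠ 0) (s : ℝ) :
    momentDet (barnesFunctional (separatesPoles_horizontalLine hy hx) s) =
      (2 * Real.pi) ^ (m + 1 + (m + 1).choose 2) *
        (exp (s * (∑ a, y a) / I) * exp (-exp s)) * ∏ a, ∏ b, Gamma ((y a - x b) / I) := by
  obtain ⟨C, hC⟩ : ∃ C : Matrix (Fin (m + 1)) (Fin (m + 1)) ℂ, ∀ k w,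
      ∏ b ∈ Finset.univ.erase k, sinh (Real.pi * (w - y b)) / Real.pi =
        ∑ l, C k l * centeredExp (m + 1) l w :=
    Classical.skolem.1 fun k => exists_prod_sinh_eq_sum (by simp) y
  obtain ⟨K, hK⟩ :=
    exists_momentDet_barnesFunctional_eq (separatesPoles_horizontalLine hy hx)
  have hlim : C.det * K = (2 * Real.pi) ^ (m + 1) *
      ((∏ k, reflectedWeight y x k (y k)) * (Matrix.vandermonde y).det) := by
    have hconst := tendsto_exp_neg_exp_atBot.const_mul (C.det * K)
    rw [mul_one] at hconst
    refine tendsto_nhds_unique hconst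
      ((tendsto_det_mul_momentDet_barnesFunctional hy hx hC).congr fun s => ?_)
    have hcancel : exp (-(s * (∑ a, y a) / I)) * exp (s * (∑ a, y a) / I) = 1 := by
      rw [← exp_add, neg_add_cancel, exp_zero]
    rw [hK]
    linear_combination (C.det * K * exp (-exp s)) * hcancel
  have hdet := det_mul_sinhVandermonde hC
  have hprod := prod_reflectedWeight_mul_vandermonde_mul_sinhVandermonde y x
  have hne : ∏ k, ∏ b ∈ Finset.univ.erase k, sinh (Real.pi * (y k - y b)) / Real.pi ≠ 0 :=
    Finset.prod_ne_zero_iff.2 fun k _ => Finset.prod_ne_zero_iff.2 fun b hb =>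
      div_ne_zero (hsinh k b (Finset.ne_of_mem_erase hb)) (ofReal_ne_zero.2 Real.pi_ne_zero)
  have hKeq : K = (2 * Real.pi) ^ (m + 1 + (m + 1).choose 2) *
      ∏ a, ∏ b, Gamma ((y a - x b) / I) := by
    refine mul_left_cancel₀ hne ?_
    rw [pow_add]
    linear_combination
      (2 * Real.pi : ℂ) ^ (m + 1).choose 2 * sinhVandermonde y * hlim - K * hdet +
        (2 * Real.pi : ℂ) ^ (m + 1) * (2 * Real.pi : ℂ) ^ (m + 1).choose 2 * hprod
  rw [hK, hKeq]
  ring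

end GenericEvaluation

section ContinuityInPoles

open Polynomial

theorem exists_norm_Gamma_add_le {u : ℝ} (hu : 0 < u) (M : ℝ) :
    ∃ C : ℝ, 0 ≤ C ∧ ∀ z : ℂ, z.re = u → ∀ r ∈ Icc 0 M,
      ‖Gamma (z + r)‖ ≤ C * ‖Gamma (z + M)‖ := by
  obtain ⟨K, hK⟩ := (isCompact_Icc (a := 0) (b := M)).exists_bound_of_continuousOn
    (f := fun r : ℝ => Gamma (u + r)) fun r hr =>
      have hGamma := differentiableAt_Gamma_of_re_pos (z := u + r)
        (by simpa using add_pos_of_pos_of_nonneg hu hr.1)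
      (hGamma.continuousAt.comp (f := fun r : ℝ => (u + r : ℂ)) (by fun_prop)).continuousWithinAt
  refine ⟨max K 0 / ‖Gamma (u + M)‖, by positivity, fun z hz r hr => ?_⟩
  have hre (t : ℝ) : (z + t).re = u + t := by simp [hz]
  have hGamma : 0 < ‖Gamma (u + M)‖ := norm_pos_iff.2 (Gamma_ne_zero_of_re_pos (by
    simpa using add_pos_of_pos_of_nonneg hu (hr.1.trans hr.2)))
  have hle := norm_Gamma_mul_norm_Gamma_re_le (z := z + r) (w := z + M)
    (by rw [hre]; exact add_pos_of_pos_of_nonneg hu hr.1) (by rw [hre, hre]; linarith [hr.2])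
    (by simp)
  rw [hre, hre, ofReal_add, ofReal_add, ← le_div_iff₀ hGamma] at hle
  refine hle.trans ?_
  rw [div_mul_eq_mul_div]
  gcongr
  exact (hK r hr).trans (le_max_left _ _)

theorem exists_norm_barnesWeight_add_le {n m : ℕ} {α : ℝ} {y : Fin n → ℂ}
    (hy : ∀ b, α < (y b).im) (x : Fin m → ℂ) (s M : ℝ) :
    ∃ C : ℝ, ∀ w : ℂ, w.im = α → ∀ r : Fin n → ℝ, (∀ b, r b ∈ Icc 0 M) →
      ‖barnesWeight s (fun b => y b + I * r b) x w‖ ≤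
        C * ‖barnesWeight s (fun b => y b + I * M) x w‖ := by
  choose C _ hC using fun b => exists_norm_Gamma_add_le (sub_pos.2 (hy b)) M
  refine ⟨∏ b, C b, fun w hw r hr => ?_⟩
  have hshift (b) (t : ℝ) : (y b + I * t - w) / I = (y b - w) / I + t := by
    rw [add_sub_right_comm, add_div, mul_div_cancel_left₀ _ I_ne_zero]
  simp only [barnesWeight, hshift, norm_mul, norm_prod]
  calc _ ≤ ‖exp (s * w / I)‖ * ((∏ b, C b * ‖Gamma ((y b - w) / I + M)‖) *
        ∏ b, ‖Gamma ((w - x b) / I)‖) := by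
        gcongr with b
        exact hC b _ (by rw [re_sub_div_I, hw]) _ (hr b)
    _ = _ := by
        rw [Finset.prod_mul_distrib]
        ring

theorem tendsto_barnesWeight_add {n m : ℕ} {y : Fin n → ℂ} {w : ℂ} (hw : ∀ b, w.im < (y b).im)
    (x : Fin m → ℂ) (s : ℝ) :
    Tendsto (fun r : Fin n → ℝ => barnesWeight s (fun b => y b + I * r b) x w) (𝓝 0)
      (𝓝 (barnesWeight s y x w)) := by
  refine ((tendsto_finsetProd _ fun b _ => ?_).mul_const _).const_mul _
  have hlin : Continuous fun r : Fin n → ℝ => (y b + I * r b - w) / I := by fun_prop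
  exact (differentiableAt_Gamma_of_re_pos (by rw [re_sub_div_I]; linarith [hw b])).continuousAt
    |>.tendsto.comp (by simpa using hlin.tendsto 0)

variable {m : ℕ} {α : ℝ} {y : Fin (m + 1) → ℂ} {x : Fin m → ℂ}

theorem tendsto_contourIntegral_mul_barnesWeight_add (hy : ∀ b, α < (y b).im)
    (hx : ∀ b, (x b).im < α) (s : ℝ) (p : ℂ[X]) (k : Fin (m + 1)) :
    Tendsto (fun r : Fin (m + 1) → ℝ => contourIntegral (horizontalLine α) fun w =>
        p.eval w * centeredExp (m + 1) k w * barnesWeight s (fun b => y b + I * r b) x w)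
      (𝓝[Ici 0] 0) (𝓝 (barnesFunctional (separatesPoles_horizontalLine hy hx) s p k)) := by
  have hadd {r : Fin (m + 1) → ℝ} (hr : 0 ≤ r) (b) : α < (y b + I * r b).im := by
    simpa using lt_add_of_lt_of_nonneg (hy b) (hr b)
  have hint {r : Fin (m + 1) → ℝ} (hr : 0 ≤ r) := by
    simpa only [(hasDerivAt_horizontalLine α _).deriv, mul_one] using
      (separatesPoles_horizontalLine (hadd hr) hx).integrable_eval_mul_centeredExp_mul s p k
  obtain ⟨C, hC⟩ := exists_norm_barnesWeight_add_le hy x s 1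
  have hIcc : ∀ᶠ r : Fin (m + 1) → ℝ in 𝓝[Ici 0] 0, ∀ b, r b ∈ Icc 0 1 := by
    have hlt : ∀ᶠ r : Fin (m + 1) → ℝ in 𝓝 0, ∀ b, r b < 1 := eventually_all.2 fun b =>
      (continuous_apply b).continuousAt.eventually_lt_const one_pos
    filter_upwards [nhdsWithin_le_nhds hlt, self_mem_nhdsWithin] with r hr hr₀ b
    exact ⟨hr₀ b, (hr b).le⟩
  simp only [barnesFunctional_apply, contourIntegral_horizontalLine]
  refine tendsto_integral_filter_of_dominated_convergence (fun t => C * ‖_‖)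
    (eventually_mem_nhdsWithin.mono fun r hr => (hint hr).1)
    (hIcc.mono fun r hr => .of_forall fun t => ?_)
    ((hint (zero_le_one : (0 : Fin (m + 1) → ℝ) ≤ 1)).norm.const_mul C)
    (.of_forall fun t => ((tendsto_barnesWeight_add hy x s).mono_left
      nhdsWithin_le_nhds).const_mul _)
  rw [norm_mul, norm_mul _ (barnesWeight _ _ _ _), mul_left_comm]
  gcongr
  exact hC _ rfl r hr

theorem eventually_sinh_mul_add_ne_zero (d : ℂ) {c : ℝ} (hc : c ≠ 0) :
    ∀ᶠ ε : ℝ in 𝓝[>] 0, sinh (Real.pi * (d + I * (ε * c : ℝ))) ≠ 0 := by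
  have hderiv : HasDerivAt (fun ε : ℝ => sinh (Real.pi * (d + I * (ε * c : ℝ))))
      (cosh (Real.pi * d) * (Real.pi * (I * c))) 0 := by
    have hlin :
        HasDerivAt (fun ε : ℝ => Real.pi * (d + I * (ε * c : ℝ))) (Real.pi * (I * c)) 0 := by
      simpa using ((((hasDerivAt_id (0 : ℝ)).mul_const c).ofReal_comp.const_mul I).const_add
        d).const_mul (Real.pi : ℂ)
    simpa [Function.comp_def] using! (hasDerivAt_sinh _).comp (0 : ℝ) hlin
  by_cases hd : sinh (Real.pi * d) = 0
  · have hcosh : cosh (Real.pi * d) ≠ 0 := by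
      intro h
      simpa [hd, h] using cosh_sq_sub_sinh_sq (Real.pi * d)
    exact nhdsGT_le_nhdsNE 0 (hderiv.eventually_ne (mul_ne_zero hcosh
      (mul_ne_zero (ofReal_ne_zero.2 Real.pi_ne_zero) (mul_ne_zero I_ne_zero
        (ofReal_ne_zero.2 hc)))))
  · exact nhdsWithin_le_nhds (hderiv.continuousAt.eventually_ne (by simpa using hd))

theorem tendsto_prod_Gamma_add (hy : ∀ b, α < (y b).im) (hx : ∀ b, (x b).im < α) :
    Tendsto (fun r : Fin (m + 1) → ℝ => ∏ a, ∏ b, Gamma ((y a + I * r a - x b) / I)) (𝓝 0)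
      (𝓝 (∏ a, ∏ b, Gamma ((y a - x b) / I))) := by
  refine tendsto_finsetProd _ fun a _ => tendsto_finsetProd _ fun b _ => ?_
  have hlin : Continuous fun r : Fin (m + 1) → ℝ => (y a + I * r a - x b) / I := by fun_prop
  refine (differentiableAt_Gamma_of_re_pos ?_).continuousAt.tendsto.comp
    (by simpa using hlin.tendsto 0)
  rw [re_sub_div_I]
  linarith [hy a, hx b]

/-- Moving the points `y b` apart in the imaginary direction makes them generic. -/
theorem momentDet_barnesFunctional_horizontalLine (hy : ∀ b, α < (y b).im)
    (hx : ∀ b, (x b).im < α) (s : ℝ) :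
    momentDet (barnesFunctional (separatesPoles_horizontalLine hy hx) s) =
      (2 * Real.pi) ^ (m + 1 + (m + 1).choose 2) *
        (exp (s * (∑ a, y a) / I) * exp (-exp s)) * ∏ a, ∏ b, Gamma ((y a - x b) / I) := by
  let r (ε : ℝ) (b : Fin (m + 1)) : ℝ := ε * (b : ℕ)
  have hr : Tendsto r (𝓝[>] 0) (𝓝[Ici 0] 0) := by
    refine tendsto_nhdsWithin_iff.2 ⟨?_, eventually_mem_nhdsWithin.mono fun ε hε b =>
      mul_nonneg (mem_Ioi.1 hε).le (Nat.cast_nonneg _)⟩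
    have hcont : Continuous r := by fun_prop
    simpa [r, funext_iff] using (hcont.tendsto' 0 0 (by ext b; simp [r])).mono_left
      (nhdsWithin_le_nhds (s := Ioi (0 : ℝ)))
  have hr₀ := hr.mono_right nhdsWithin_le_nhds
  have hdet : Tendsto (fun ε => (Matrix.of fun j k : Fin (m + 1) =>
      contourIntegral (horizontalLine α) fun w => (X ^ (j : ℕ)).eval w * centeredExp (m + 1) k w *
        barnesWeight s (fun b => y b + I * r ε b) x w).det) (𝓝[>] 0)
      (𝓝 (momentDet (barnesFunctional (separatesPoles_horizontalLine hy hx) s))) :=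
    (continuous_id.matrix_det.tendsto _).comp (tendsto_pi_nhds.2 fun j => tendsto_pi_nhds.2 fun k =>
      (tendsto_contourIntegral_mul_barnesWeight_add hy hx s _ k).comp hr)
  have hexp : Continuous fun r : Fin (m + 1) → ℝ =>
      (2 * Real.pi : ℂ) ^ (m + 1 + (m + 1).choose 2) *
        (exp (s * (∑ a, (y a + I * r a)) / I) * exp (-exp s)) := by fun_prop
  have hvalue := ((hexp.tendsto 0).mul (tendsto_prod_Gamma_add hy hx)).comp hr₀
  simp only [Pi.zero_apply, ofReal_zero, mul_zero, add_zero] at hvalue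
  refine tendsto_nhds_unique (hdet.congr' ?_) hvalue
  have hne : ∀ᶠ ε : ℝ in 𝓝[>] 0, ∀ k, ∀ b ≠ k,
      sinh (Real.pi * (y k - y b + I * (ε * ((k : ℕ) - (b : ℕ)) : ℝ))) ≠ 0 :=
    eventually_all.2 fun k => eventually_all.2 fun b => eventually_imp_distrib_left.2 fun hbk =>
      eventually_sinh_mul_add_ne_zero _ (sub_ne_zero.2 (Nat.cast_injective.ne
        (Fin.val_injective.ne hbk.symm)))
  filter_upwards [hne, hr.eventually self_mem_nhdsWithin] with ε hsinh hε
  refine momentDet_barnesFunctional_horizontalLine_of_sinh_ne_zero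
    (y := fun b => y b + I * r ε b) (fun b => by simpa using lt_add_of_lt_of_nonneg (hy b) (hε b))
    hx (fun k b hb => ?_) s
  convert! hsinh k b hb using 3
  simp only [r]
  push_cast
  ring

end ContinuityInPoles

section Descent

variable {m : ℕ} {y : Fin (m + 1) → ℂ} {x : Fin m → ℂ} {γ : ℝ → ℂ}

theorem prod_Gamma_piecewise_singleton {n : ℕ} {y : Fin n → ℂ} {b : Fin m}
    (h : ∀ a, y a ≠ x b) :
    ∏ a, ∏ c, Gamma ((y a - ({b} : Finset (Fin m)).piecewise (fun c => x c - I) x c) / I) =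
      (∏ a, (y a - x b) / I) * ∏ a, ∏ c, Gamma ((y a - x c) / I) := by
  rw [← Finset.prod_mul_distrib]
  refine Finset.prod_congr rfl fun a _ => ?_
  rw [Fintype.prod_eq_mul_prod_compl b, Fintype.prod_eq_mul_prod_compl b fun c => Gamma _,
    Finset.piecewise_singleton, Function.update_self, ← mul_assoc,
    ← Gamma_add_one _ (div_ne_zero (sub_ne_zero.2 (h a)) I_ne_zero), sub_sub_eq_add_sub,
    add_sub_right_comm, add_div, div_self I_ne_zero]
  refine congrArg _ (Finset.prod_congr rfl fun c hc => ?_)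
  rw [Function.update_of_ne (by simpa using hc)]

/-- Lowering the points `x b` by multiples of `I` brings them below a horizontal line. -/
theorem momentDet_barnesFunctional_eq_of_sum_eq {α : ℝ} (hy : ∀ a, α < (y a).im) (s : ℝ)
    (N : ℕ) (v : Fin m → ℕ) (hv : ∑ b, v b = N) (hx : ∀ b, (x b).im - v b < α)
    (h : SeparatesPoles γ y x) :
    momentDet (barnesFunctional h s) = (2 * Real.pi) ^ (m + 1 + (m + 1).choose 2) *
      (exp (s * (∑ a, y a) / I) * exp (-exp s)) * ∏ a, ∏ b, Gamma ((y a - x b) / I) := by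
  induction N generalizing x v with
  | zero =>
    have hx₀ (b) : (x b).im < α := by
      simpa [Finset.sum_eq_zero_iff.1 hv b (Finset.mem_univ b)] using hx b
    rw [barnesFunctional_eq h (separatesPoles_horizontalLine hy hx₀),
      momentDet_barnesFunctional_horizontalLine hy hx₀]
  | succ N ih =>
    obtain ⟨b, -, hb⟩ := Finset.exists_ne_zero_of_sum_ne_zero (hv.trans_ne N.succ_ne_zero)
    obtain ⟨u, hu⟩ := Nat.exists_eq_succ_of_ne_zero hb
    have hsum : ∑ c, Function.update v b u c = N := by
      have hupdate := Finset.sum_update_of_mem (Finset.mem_univ b) v u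
      have hsplit := Finset.add_sum_erase _ v (Finset.mem_univ b)
      rw [Finset.sdiff_singleton_eq_erase] at hupdate
      omega
    have hlow (c) : (({b} : Finset (Fin m)).piecewise (fun c => x c - I) x c).im -
        Function.update v b u c < α := by
      rw [Finset.piecewise_singleton]
      rcases eq_or_ne c b with rfl | hcb
      · simpa [hu, sub_sub, add_comm] using hx c
      · simpa [hcb] using hx c
    have hstep := ih _ hsum hlow (h.piecewise_sub_I {b})
    rw [momentDet_barnesFunctional_piecewise_singleton h,
      prod_Gamma_piecewise_singleton fun a => h.left_ne_right a b, mul_left_comm] at hstep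
    exact mul_left_cancel₀ (Finset.prod_ne_zero_iff.2 fun a _ =>
      div_ne_zero (sub_ne_zero.2 (h.left_ne_right a b)) I_ne_zero) hstep

theorem momentDet_barnesFunctional_eq (h : SeparatesPoles γ y x) (s : ℝ) :
    momentDet (barnesFunctional h s) = (2 * Real.pi) ^ (m + 1 + (m + 1).choose 2) *
      (exp (s * (∑ a, y a) / I) * exp (-exp s)) * ∏ a, ∏ b, Gamma ((y a - x b) / I) := by
  obtain ⟨α, hα⟩ : ∃ α : ℝ, ∀ a, α < (y a).im :=
    (eventually_all.2 fun a => eventually_lt_atBot (y a).im).exists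
  choose v hv using fun b => exists_nat_gt ((x b).im - α)
  exact momentDet_barnesFunctional_eq_of_sum_eq hα s _ v rfl (fun b => by linarith [hv b]) h

end Descent

section MultipleIntegral

variable {n m : ℕ} {γ : ℝ → ℂ} {ℏ : ℝ}

theorem gammaIntegrand_eq_det_mul_det_mul_prod (ℏ s : ℝ) (y : Fin n → ℂ) (x : Fin m → ℂ)
    (w : Fin n → ℂ) :
    (2 * Real.pi) ^ n.choose 2 * gammaIntegrand ℏ s y x w =
      (Matrix.vandermonde fun a => w a / ℏ).det *
        (Matrix.of fun k a : Fin n => centeredExp n k (w a / ℏ)).det *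
        ∏ a, barnesWeight s (fun b => y b / ℏ) (fun b => x b / ℏ) (w a / ℏ) := by
  have hdiv (u v : ℂ) : (u / ℏ - v / ℏ) / I = (u - v) / (I * ℏ) := by
    rw [← sub_div, div_div, mul_comm]
  have hexp : ∏ a, exp (s * (w a / ℏ) / I) = exp (s * (∑ a, w a) / (I * ℏ)) := by
    rw [← exp_sum, ← Finset.sum_div, ← Finset.mul_sum, ← Finset.sum_div, mul_div_assoc',
      div_div, mul_comm I]
  have hinv := inv_prod_offDiag_Gamma fun a => w a / ℏ
  simp only [hdiv] at hinv
  simp only [gammaIntegrand, barnesWeight, hdiv, Finset.prod_mul_distrib, hexp]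
  rw [← sinhVandermonde_eq_det, div_eq_mul_inv, hinv]
  ring

theorem contourPullback_gammaIntegrand_eq (hℏ : ℏ ≠ 0) (s : ℝ) (y : Fin n → ℂ) (x : Fin m → ℂ)
    (t : Fin n → ℝ) :
    (2 * Real.pi) ^ n.choose 2 * contourPullback γ (gammaIntegrand ℏ s y x) t =
      ℏ ^ n * ((Matrix.of fun j a : Fin n => (γ (t a) / ℏ) ^ (j : ℕ)).det *
        (Matrix.of fun k a : Fin n => centeredExp n k (γ (t a) / ℏ) *
          (barnesWeight s (fun b => y b / ℏ) (fun b => x b / ℏ) (γ (t a) / ℏ) *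
            deriv (fun t => γ t / ℏ) (t a))).det) := by
  have hderiv : ∏ a, deriv γ (t a) = ℏ ^ n * ∏ a, deriv (fun t => γ t / ℏ) (t a) := by
    simp only [deriv_div_const, Finset.prod_div_distrib, Finset.prod_const, Finset.card_univ,
      Fintype.card_fin]
    rw [mul_div_cancel₀ _ (pow_ne_zero _ (ofReal_ne_zero.2 hℏ))]
  have hrow := Matrix.det_mul_row (fun a => barnesWeight s (fun b => y b / ℏ) (fun b => x b / ℏ)
    (γ (t a) / ℏ) * deriv (fun t => γ t / ℏ) (t a))
    (Matrix.of fun k a : Fin n => centeredExp n k (γ (t a) / ℏ))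
  simp only [Matrix.of_apply, mul_comm _ (centeredExp _ _ _), Finset.prod_mul_distrib] at hrow
  have hvandermonde : (Matrix.of fun j a : Fin n => (γ (t a) / ℏ) ^ (j : ℕ)) =
      (Matrix.vandermonde fun a => γ (t a) / ℏ).transpose := rfl
  rw [hrow, hvandermonde, Matrix.det_transpose, contourPullback, hderiv, ← mul_assoc,
    gammaIntegrand_eq_det_mul_det_mul_prod]
  ring

variable {y : Fin (m + 1) → ℂ} {x : Fin m → ℂ}

theorem separatesPoles_div (hℏ : 0 < ℏ) (hγ : IsStripContour γ)
    (hy : ∀ a (k : ℕ), LiesAbove γ (y a + I * ℏ * k))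
    (hx : ∀ b (k : ℕ), LiesBelow γ (x b - I * ℏ * k)) :
    SeparatesPoles (fun t => γ t / ℏ) (fun b => y b / ℏ) fun b => x b / ℏ := by
  have hℏ₀ : (ℏ : ℂ) ≠ 0 := ofReal_ne_zero.2 hℏ.ne'
  have hscale (u : ℂ) : u / ℏ = (ℏ⁻¹ : ℝ) * u + 0 := by
    rw [ofReal_inv, add_zero, inv_mul_eq_div]
  have hshift (k : ℕ) : I * ℏ * k / ℏ = I * k := by field_simp
  refine ⟨?_, fun b k => ?_, fun b k => ?_⟩
  · simpa only [hscale] using hγ.mul_add_const (inv_pos.2 hℏ) 0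
  · rw [← hshift, ← add_div]
    simpa only [hscale] using (hy b k).mul_add_const (inv_pos.2 hℏ) 0
  · rw [← hshift, ← sub_div]
    simpa only [hscale] using (hx b k).mul_add_const (inv_pos.2 hℏ) 0

open Polynomial in
theorem SeparatesPoles.integrable_pow_mul_centeredExp_mul (h : SeparatesPoles γ y x) (s : ℝ)
    (j k : Fin (m + 1)) :
    Integrable fun t => γ t ^ (j : ℕ) *
      (centeredExp (m + 1) k (γ t) * (barnesWeight s y x (γ t) * deriv γ t)) := by
  simpa only [eval_pow, eval_X, mul_assoc] using
    h.integrable_eval_mul_centeredExp_mul s (X ^ (j : ℕ)) k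

theorem integrable_contourPullback_gammaIntegrand (hℏ : ℏ ≠ 0)
    (h : SeparatesPoles (fun t => γ t / ℏ) (fun b => y b / ℏ) fun b => x b / ℏ) (s : ℝ) :
    Integrable (contourPullback γ (gammaIntegrand ℏ s y x)) := by
  have hdet := integrable_det_mul_det (h.integrable_pow_mul_centeredExp_mul s)
  rw [← integrable_const_mul_iff (c := (2 * Real.pi : ℂ) ^ (m + 1).choose 2)
    (IsUnit.mk0 _ (by simp [Real.pi_ne_zero]))]
  simpa only [contourPullback_gammaIntegrand_eq hℏ] using! hdet.const_mul ((ℏ : ℂ) ^ (m + 1))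

open Polynomial in
theorem integral_contourPullback_gammaIntegrand (hℏ : ℏ ≠ 0)
    (h : SeparatesPoles (fun t => γ t / ℏ) (fun b => y b / ℏ) fun b => x b / ℏ) (s : ℝ) :
    (2 * Real.pi) ^ (m + 1).choose 2 * ∫ t, contourPullback γ (gammaIntegrand ℏ s y x) t =
      ℏ ^ (m + 1) * ((m + 1).factorial * momentDet (barnesFunctional h s)) := by
  have hdet := integral_det_mul_det (h.integrable_pow_mul_centeredExp_mul s)
  rw [← volume_pi, Fintype.card_fin] at hdet
  rw [← integral_const_mul]
  simp only [contourPullback_gammaIntegrand_eq hℏ]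
  rw [integral_const_mul, hdet]
  simp only [momentDet, barnesFunctional, contourIntegral, LinearMap.coe_mk, AddHom.coe_mk,
    eval_pow, eval_X, mul_assoc]

theorem integral_contourPullback_gammaIntegrand_div (hℏ : ℏ ≠ 0)
    (h : SeparatesPoles (fun t => γ t / ℏ) (fun b => y b / ℏ) fun b => x b / ℏ) (s : ℝ) :
    (∫ t, contourPullback γ (gammaIntegrand ℏ s y x) t) / (2 * Real.pi * ℏ : ℂ) ^ (m + 1) =
      (m + 1).factorial * exp (s * (∑ a, y a) / (I * ℏ)) * exp (-exp s) *
        ∏ a, ∏ b, Gamma ((y a - x b) / (I * ℏ)) := by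
  have hpi : (2 * Real.pi : ℂ) ≠ 0 := mul_ne_zero two_ne_zero (ofReal_ne_zero.2 Real.pi_ne_zero)
  rw [div_eq_iff (pow_ne_zero _ (mul_ne_zero hpi (ofReal_ne_zero.2 hℏ)))]
  refine mul_left_cancel₀ (pow_ne_zero ((m + 1).choose 2) hpi) ?_
  rw [integral_contourPullback_gammaIntegrand hℏ h s, momentDet_barnesFunctional_eq]
  simp only [← sub_div, ← Finset.sum_div, ← mul_div_assoc, div_div, mul_comm (ℏ : ℂ) I]
  ring

end MultipleIntegral

theorem mainTheorem7 (n : ℕ) (hn : 1 ≤ n) (ℏ : ℝ) (hℏ : 0 < ℏ) (s : ℝ)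
    (y : Fin n → ℂ) (x : Fin (n - 1) → ℂ) (γ : ℝ → ℂ) (hγ : IsStripContour γ)
    (hy : ∀ (a : Fin n) (k : ℕ), LiesAbove γ (y a + Complex.I * ℏ * k))
    (hx : ∀ (b : Fin (n - 1)) (k : ℕ), LiesBelow γ (x b - Complex.I * ℏ * k)) :
    MeasureTheory.Integrable (contourPullback γ (gammaIntegrand ℏ s y x)) ∧
    (∫ t : Fin n → ℝ, contourPullback γ (gammaIntegrand ℏ s y x) t) /
        (2 * Real.pi * ℏ : ℂ) ^ n =
      n.factorial * Complex.exp (s * (∑ a, y a) / (Complex.I * ℏ)) *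
        Complex.exp (-Complex.exp s) *
        ∏ a, ∏ b, Complex.Gamma ((y a - x b) / (Complex.I * ℏ)) := by
  obtain ⟨m, rfl⟩ := Nat.exists_eq_add_of_le' hn
  have h := separatesPoles_div (m := m) hℏ hγ hy hx
  exact ⟨integrable_contourPullback_gammaIntegrand hℏ.ne' h s,
    integral_contourPullback_gammaIntegrand_div hℏ.ne' h s⟩
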